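/- Let $\mathcal X,\mathcal Y,\hat{\mathcal X}_1,\hat{\mathcal X}_2$ be finite alphabets, let $(X_i,Y_i)$, $i\ge 1$, be i.i.d. with law $P(x,y)$ on $\mathcal X\times\mathcal Y$, let $d_j:\mathcal X\times\hat{\mathcal X}_j\to[0,\infty)$, $j=1,2$, be distortion measures, and let $D_1,D_2\in\mathbb R$. An $(n,M_1,M_2,\Delta_1,\Delta_2)$ code consists of encoders $f_1:\mathcal X^n\times\mathcal Y^n\to\{1,\dots,M_1\}$ and $f_2:\mathcal Y^n\times\{1,\dots,M_1\}\to\{1,\dots,M_2\}$ and decoders $g_1:\mathcal Y^n\times\{1,\dots,M_1\}\to\hat{\mathcal X}_1^n$ and $g_2:\{1,\dots,M_2\}\to\hat{\mathcal X}_2^n$ such that, with $T_1=f_1(X^n,Y^n)$, $T_2=f_2(Y^n,T_1)$, $\hat X_1^n=g_1(Y^n,T_1)$ and $\hat X_2^n=g_2(T_2)$, $$\mathbb E\Big[\frac1n\sum_{i=1}^n d_j(X_i,\hat X_{j,i})\Big]\le \Delta_j,\qquad j=1,2$$ (the source encoder and User 1 see the side information $Y^n$; User 2 does not). A rate pair $(R_1,R_2)\in\mathbb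 R^2$ is achievable if for every $\epsilon>0$ and all sufficiently large $n$ there exists an $(n,\lfloor 2^{nR_1}\rfloor,\lfloor 2^{nR_2}\rfloor,D_1+\epsilon,D_2+\epsilon)$ code (so achievable rates are nonnegative). Let $\mathcal R^O(D_1,D_2)$ be the closure of the set of all achievable rate pairs. Let $\mathcal R(D_1,D_2)$ be the set of all $(R_1,R_2)$ such that $$R_2\ge I(X,Y;\hat X_2),\qquad R_1\ge I(X;\hat X_1,\hat X_2\mid Y)$$ (information in bits) for some joint distribution of the form $P(x,y)P(\hat x_1,\hat x_2\mid x,y)$ on $\mathcal X\times\mathcal Y\times\hat{\mathcal X}_1\times\hat{\mathcal X}_2$, with the given $P(x,y)$, for which $\mathbb E\,d_j(X,\hat X_j)\le D_j$, $j=1,2$. Then $$\mathcal R^O(D_1,D_2)=\mathcal R(D_1,D_2).$$ -/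

import Mathlib

noncomputable section

namespace Cascade

/-! ### Information measures (in bits) of random variables on a finite probability space

A finite probability space is a finite type `Ω` with a probability mass function `p : Ω → ℝ`;
random variables are functions on `Ω`. -/

section Information

variable {Ω α β γ : Type*} [Fintype Ω] [Fintype α] [Fintype β] [Fintype γ]

open Classical in
/-- The probability mass function of the random variable `U`: `law p U u = Pr[U = u]`. -/
def law (p : Ω → ℝ) (U : Ω → α) (u : α) : ℝ :=
  ∑ ω : Ω, if U ω = u then p ω else 0

/-- Mutual information `I(U; V)` in bits. Terms with `Pr[U = u, V = v] = 0` vanish. -/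
def mutualInfo (p : Ω → ℝ) (U : Ω → α) (V : Ω → β) : ℝ :=
  ∑ u : α, ∑ v : β,
    law p (fun ω => (U ω, V ω)) (u, v) *
      Real.logb 2 (law p (fun ω => (U ω, V ω)) (u, v) / (law p U u * law p V v))

/-- Conditional mutual information `I(U; V | Z)` in bits.
Terms with `Pr[U = u, V = v, Z = z] = 0` vanish. -/
def condMutualInfo (p : Ω → ℝ) (U : Ω → α) (V : Ω → β) (Z : Ω → γ) : ℝ :=
  ∑ u : α, ∑ v : β, ∑ z : γ,
    law p (fun ω => (U ω, V ω, Z ω)) (u, v, z) *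
      Real.logb 2
        (law p (fun ω => (U ω, V ω, Z ω)) (u, v, z) * law p Z z /
          (law p (fun ω => (U ω, Z ω)) (u, z) * law p (fun ω => (V ω, Z ω)) (v, z)))

end Information

/-! ### Codes and the operational region -/

section Coding

variable {X Y Xh1 Xh2 : Type*} [Fintype X] [Fintype Y] [Fintype Xh1] [Fintype Xh2]

/-- The encoding and decoding maps of a cascade code of block length `n` with message sets of
sizes `M1` and `M2`. The encoder and User 1 see the side information, User 2 does not. -/
structure Code (X Y Xh1 Xh2 : Type*) (n M1 M2 : ℕ) where
  /-- The source encoder. -/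
  f1 : (Fin n → X) → (Fin n → Y) → Fin M1
  /-- The encoder at User 1. -/
  f2 : (Fin n → Y) → Fin M1 → Fin M2
  /-- The decoder at User 1. -/
  g1 : (Fin n → Y) → Fin M1 → (Fin n → Xh1)
  /-- The decoder at User 2. -/
  g2 : Fin M2 → (Fin n → Xh2)

/-- Reconstruction at User 1. -/
def Code.recon1 {n M1 M2 : ℕ} (c : Code X Y Xh1 Xh2 n M1 M2)
    (x : Fin n → X) (y : Fin n → Y) : Fin n → Xh1 :=
  c.g1 y (c.f1 x y)

/-- Reconstruction at User 2. -/
def Code.recon2 {n M1 M2 : ℕ} (c : Code X Y Xh1 Xh2 n M1 M2)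
    (x : Fin n → X) (y : Fin n → Y) : Fin n → Xh2 :=
  c.g2 (c.f2 y (c.f1 x y))

/-- Distortion between sequences: the average of the single-letter distortions. -/
def seqDist {A B : Type*} (d : A → B → ℝ) {n : ℕ} (a : Fin n → A) (b : Fin n → B) : ℝ :=
  (1 / (n : ℝ)) * ∑ j : Fin n, d (a j) (b j)

/-- Expectation of `φ(Xⁿ, Yⁿ)` where the pairs `(X_i, Y_i)` are i.i.d. with law `P`. -/
def expectIID (P : X × Y → ℝ) {n : ℕ} (φ : (Fin n → X) → (Fin n → Y) → ℝ) : ℝ :=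
  ∑ x : Fin n → X, ∑ y : Fin n → Y, (∏ i : Fin n, P (x i, y i)) * φ x y

/-- The code satisfies both expected distortion constraints. -/
def Code.MeetsDistortion (P : X × Y → ℝ) (d1 : X → Xh1 → ℝ) (d2 : X → Xh2 → ℝ) {n M1 M2 : ℕ}
    (c : Code X Y Xh1 Xh2 n M1 M2) (D1 D2 : ℝ) : Prop :=
  expectIID P (fun x y => seqDist d1 x (c.recon1 x y)) ≤ D1 ∧
  expectIID P (fun x y => seqDist d2 x (c.recon2 x y)) ≤ D2

/-- Achievability of a rate pair `(R1, R2)` at distortions `(D1, D2)`; the message set sizes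
`2 ^ (n R_i)` are rounded down to integers. (For a negative rate the message set is empty as
soon as `n ≥ 1`, so there is no code.) -/
def Achievable (P : X × Y → ℝ) (d1 : X → Xh1 → ℝ) (d2 : X → Xh2 → ℝ) (D1 D2 : ℝ)
    (R : ℝ × ℝ) : Prop :=
  ∀ ε : ℝ, 0 < ε → ∃ N : ℕ, ∀ n : ℕ, N ≤ n →
    ∃ c : Code X Y Xh1 Xh2 n ⌊(2 : ℝ) ^ ((n : ℝ) * R.1)⌋₊ ⌊(2 : ℝ) ^ ((n : ℝ) * R.2)⌋₊,
      c.MeetsDistortion P d1 d2 (D1 + ε) (D2 + ε)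

/-- The operational achievable region. -/
def operationalRegion (P : X × Y → ℝ) (d1 : X → Xh1 → ℝ) (d2 : X → Xh2 → ℝ) (D1 D2 : ℝ) :
    Set (ℝ × ℝ) :=
  closure {R : ℝ × ℝ | Achievable P d1 d2 D1 D2 R}

/-! ### The single-letter region -/

/-- The joint law `P(x, y) P(x̂₁, x̂₂ | x, y)` on quadruples `(x, y, x̂₁, x̂₂)`. -/
def joint (P : X × Y → ℝ) (W : X × Y → Xh1 × Xh2 → ℝ) : X × Y × Xh1 × Xh2 → ℝ :=
  fun ω => P (ω.1, ω.2.1) * W (ω.1, ω.2.1) (ω.2.2.1, ω.2.2.2)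

/-- The single-letter region: the union over all conditional laws `W = P(x̂₁, x̂₂ | x, y)` that
meet the distortion constraints. -/
def singleLetterRegion (P : X × Y → ℝ) (d1 : X → Xh1 → ℝ) (d2 : X → Xh2 → ℝ) (D1 D2 : ℝ) :
    Set (ℝ × ℝ) :=
  {R : ℝ × ℝ | ∃ W : X × Y → Xh1 × Xh2 → ℝ,
    (∀ s : X × Y, W s ∈ stdSimplex ℝ (Xh1 × Xh2)) ∧
    (∑ ω : X × Y × Xh1 × Xh2, joint P W ω * d1 ω.1 ω.2.2.1) ≤ D1 ∧
    (∑ ω : X × Y × Xh1 × Xh2, joint P W ω * d2 ω.1 ω.2.2.2) ≤ D2 ∧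
    mutualInfo (joint P W)
      (fun ω : X × Y × Xh1 × Xh2 => (ω.1, ω.2.1)) (fun ω => ω.2.2.2) ≤ R.2 ∧
    condMutualInfo (joint P W)
      (fun ω : X × Y × Xh1 × Xh2 => ω.1) (fun ω => ω.2.2) (fun ω => ω.2.1) ≤ R.1}

end Coding

end Cascade

end

/-! The two inclusions are proved by direct arguments on finite sums.

*Converse.* Given a code, let `q` be the joint law of source and reconstructions at a uniformly
distributed time. The number `n I(X, Y; X̂₂)` computed under `q` is the expectation of the logarithm
of `Z = ∏ᵢ q(xᵢ, yᵢ | x̂₂ᵢ) / P(xᵢ, yᵢ)`, where `x̂₂` is the reconstruction of `(x, y)`. There are only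
`M₂` possible sequences `x̂₂`, and for each of them `∏ᵢ q(xᵢ, yᵢ | x̂₂ᵢ)` sums to one; so `E Z ≤ M₂`, and
`n I ≤ log M₂` by Jensen's inequality. The same computation, conditioned on the side information,
gives `n I(X; X̂₁, X̂₂ | Y) ≤ log M₁`. No chain rule and no separate convexity argument are needed
(`sum_logb_ratio_le`, `Code.exists_channel`). As the conditional laws form a compact set on which
distortions and informations are continuous, the slack in the definition of achievability and the
closure are absorbed by a limit (`operationalRegion_subset`).

*Achievability.* Draw a codebook for User 2 of slightly more than `2 ^ (n I(X, Y; X̂₂))` words, so that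
some word is jointly typical with `(x, y)`. The encoder and User 1 both know `y`, so the encoder
describes the word by its index among the words that are typical with `y`; of these there are about
`2 ^ (n (I(X, Y; X̂₂) - I(Y; X̂₂))) = 2 ^ (n I(X; X̂₂ | Y))`. A second codebook, of
`2 ^ (n I(X; X̂₁ | Y, X̂₂))` words for each `y` and each word for User 2, provides `x̂₁`. The exponents
add up to `I(X; X̂₁, X̂₂ | Y)`. The construction is carried out for a single use of an arbitrary finite
source (`exists_oneShot_code`) and applied to blocks, for which the weak law of large numbers controls
information densities and distortions (`exists_block_code`).
-/

namespace Cascade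

/-! ### Information identities -/

section Info

variable {Ω α β γ δ : Type*} [Fintype Ω]

theorem law_nonneg {p : Ω → ℝ} (hp : ∀ ω, 0 ≤ p ω) (U : Ω → α) (u : α) : 0 ≤ law p U u :=
  Finset.sum_nonneg fun ω _ => by split_ifs <;> simp [hp]

theorem le_law {p : Ω → ℝ} (hp : ∀ ω, 0 ≤ p ω) (U : Ω → α) (ω : Ω) : p ω ≤ law p U (U ω) := by
  classical
  have h := Finset.single_le_sum (f := fun ω' => if U ω' = U ω then p ω' else 0)
    (fun ω' _ => by split_ifs <;> simp [hp]) (Finset.mem_univ ω)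
  simp only [if_true] at h
  exact h.trans (le_of_eq (Finset.sum_congr rfl fun _ _ => by congr))

theorem law_pos {p : Ω → ℝ} (hp : ∀ ω, 0 ≤ p ω) (U : Ω → α) {ω : Ω} (h : 0 < p ω) :
    0 < law p U (U ω) := h.trans_le (le_law hp U ω)

/-- The law of a tuple does not depend on how the tuple is arranged. -/
theorem law_congr (p : Ω → ℝ) (U : Ω → α) (V : Ω → β) (ω : Ω)
    (h : ∀ ω', U ω' = U ω ↔ V ω' = V ω) : law p U (U ω) = law p V (V ω) := by
  classical
  exact Finset.sum_congr rfl fun ω' _ => by simp only [h]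

/-- Change of variables: expectations of functions of `U` can be computed from the law of `U`. -/
theorem sum_law_mul [Fintype α] (p : Ω → ℝ) (U : Ω → α) (F : α → ℝ) :
    ∑ u, law p U u * F u = ∑ ω, p ω * F (U ω) := by
  classical
  simp only [law, Finset.sum_mul]
  rw [Finset.sum_comm]
  refine Finset.sum_congr rfl fun ω _ => ?_
  rw [Finset.sum_eq_single (U ω)] <;> simp +contextual [eq_comm]

theorem sum_law [Fintype α] (p : Ω → ℝ) (U : Ω → α) : ∑ u, law p U u = ∑ ω, p ω := by
  simpa using sum_law_mul p U (fun _ => 1)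

/-- Summing out the first of two variables. -/
theorem sum_law_left [Fintype α] (p : Ω → ℝ) (U : Ω → α) (V : Ω → β) (v : β) :
    ∑ u, law p (fun ω => (U ω, V ω)) (u, v) = law p V v := by
  classical
  simp only [law]
  rw [Finset.sum_comm]
  refine Finset.sum_congr rfl fun ω _ => ?_
  rw [Finset.sum_eq_single (U ω)] <;> simp +contextual [eq_comm]

/-- Summing out the second of two variables. -/
theorem sum_law_right [Fintype β] (p : Ω → ℝ) (U : Ω → α) (V : Ω → β) (u : α) :
    ∑ v, law p (fun ω => (U ω, V ω)) (u, v) = law p U u := by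
  classical
  simp only [law]
  rw [Finset.sum_comm]
  refine Finset.sum_congr rfl fun ω _ => ?_
  rw [Finset.sum_eq_single (V ω)] <;> simp +contextual [eq_comm]

variable [Fintype α] [Fintype β] [Fintype γ] [Fintype δ]

/-- Mutual information as the expectation of the information density. -/
theorem mutualInfo_eq_sum (p : Ω → ℝ) (U : Ω → α) (V : Ω → β) :
    mutualInfo p U V = ∑ ω, p ω * Real.logb 2
      (law p (fun ω => (U ω, V ω)) (U ω, V ω) / (law p U (U ω) * law p V (V ω))) := by
  rw [← sum_law_mul p (fun ω => (U ω, V ω)) (fun w => Real.logb 2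
      (law p (fun ω => (U ω, V ω)) w / (law p U w.1 * law p V w.2))), Fintype.sum_prod_type]
  rfl

/-- Conditional mutual information as the expectation of the conditional information density. -/
theorem condMutualInfo_eq_sum (p : Ω → ℝ) (U : Ω → α) (V : Ω → β) (Z : Ω → γ) :
    condMutualInfo p U V Z = ∑ ω, p ω * Real.logb 2
      (law p (fun ω => (U ω, V ω, Z ω)) (U ω, V ω, Z ω) * law p Z (Z ω) /
        (law p (fun ω => (U ω, Z ω)) (U ω, Z ω) * law p (fun ω => (V ω, Z ω)) (V ω, Z ω))) := by
  rw [← sum_law_mul p (fun ω => (U ω, V ω, Z ω)) (fun w => Real.logb 2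
      (law p (fun ω => (U ω, V ω, Z ω)) w * law p Z w.2.2 /
        (law p (fun ω => (U ω, Z ω)) (w.1, w.2.2) *
          law p (fun ω => (V ω, Z ω)) (w.2.1, w.2.2)))), Fintype.sum_prod_type]
  simp only [Fintype.sum_prod_type]
  rfl

theorem mutualInfo_eq_condMutualInfo (p : Ω → ℝ) (hp1 : ∑ ω, p ω = 1) (U : Ω → α) (V : Ω → β) :
    mutualInfo p U V = condMutualInfo p U V (fun _ => ()) := by
  rw [mutualInfo_eq_sum, condMutualInfo_eq_sum]
  refine Finset.sum_congr rfl fun ω _ => ?_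
  rw [law_congr p (fun ω => (U ω, V ω)) (fun ω => (U ω, V ω, ())) ω (by simp),
    law_congr p U (fun ω => (U ω, ())) ω (by simp),
    law_congr p V (fun ω => (V ω, ())) ω (by simp)]
  simp [law, hp1]

/-- Gibbs' inequality: an information density `log z` has nonnegative mean as soon as `1 / z` has
mean at most one. -/
theorem sum_mul_logb_nonneg {p z : Ω → ℝ} (hp : ∀ ω, 0 ≤ p ω) (hp1 : ∑ ω, p ω = 1)
    (hz : ∀ ω, 0 < p ω → 0 < z ω) (h : ∑ ω, p ω * (z ω)⁻¹ ≤ 1) :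
    0 ≤ ∑ ω, p ω * Real.logb 2 (z ω) := by
  have key : ∀ ω, p ω - p ω * (z ω)⁻¹ ≤ p ω * Real.log (z ω) := by
    intro ω
    rcases (hp ω).eq_or_lt with h0 | h0
    · simp [← h0]
    · have := Real.log_le_sub_one_of_pos (inv_pos.2 (hz ω h0))
      rw [Real.log_inv] at this
      nlinarith
  have h1 : 0 ≤ ∑ ω, p ω * Real.log (z ω) := by
    refine le_trans ?_ (Finset.sum_le_sum fun ω _ => key ω)
    rw [Finset.sum_sub_distrib, hp1]; linarith
  have h2 : ∑ ω, p ω * Real.logb 2 (z ω) = (∑ ω, p ω * Real.log (z ω)) / Real.log 2 := by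
    rw [Finset.sum_div]; exact Finset.sum_congr rfl fun ω _ => by rw [Real.logb, mul_div_assoc]
  rw [h2]
  exact div_nonneg h1 (Real.log_nonneg (by norm_num))

theorem condMutualInfo_nonneg {p : Ω → ℝ} (hp : ∀ ω, 0 ≤ p ω) (hp1 : ∑ ω, p ω = 1)
    (U : Ω → α) (V : Ω → β) (Z : Ω → γ) : 0 ≤ condMutualInfo p U V Z := by
  rw [condMutualInfo_eq_sum]
  refine sum_mul_logb_nonneg hp hp1 (fun ω h => ?_) ?_
  · have h1 := law_pos hp (fun ω => (U ω, V ω, Z ω)) h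
    have h2 := law_pos hp Z h
    have h3 := law_pos hp (fun ω => (U ω, Z ω)) h
    have h4 := law_pos hp (fun ω => (V ω, Z ω)) h
    positivity
  · rw [← sum_law_mul p (fun ω => (U ω, V ω, Z ω)) (fun w =>
      (law p (fun ω => (U ω, V ω, Z ω)) w * law p Z w.2.2 /
        (law p (fun ω => (U ω, Z ω)) (w.1, w.2.2) *
          law p (fun ω => (V ω, Z ω)) (w.2.1, w.2.2)))⁻¹), Fintype.sum_prod_type]
    calc _ ≤ ∑ u, ∑ w : β × γ, law p (fun ω => (U ω, Z ω)) (u, w.2) *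
            law p (fun ω => (V ω, Z ω)) w / law p Z w.2 := by
          refine Finset.sum_le_sum fun u _ => Finset.sum_le_sum fun w _ => ?_
          have h0 := law_nonneg hp (fun ω => (U ω, V ω, Z ω)) (u, w)
          have h2 := law_nonneg hp Z w.2
          have h3 := law_nonneg hp (fun ω => (U ω, Z ω)) (u, w.2)
          have h4 := law_nonneg hp (fun ω => (V ω, Z ω)) w
          rcases h0.eq_or_lt with h1 | h1
          · rw [← h1, zero_mul]; positivity
          · refine le_of_eq ?_
            rw [inv_div]
            field_simp
      _ = ∑ w : β × γ, law p Z w.2 * law p (fun ω => (V ω, Z ω)) w / law p Z w.2 := by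
          rw [Finset.sum_comm]
          refine Finset.sum_congr rfl fun w _ => ?_
          rw [← Finset.sum_div, ← Finset.sum_mul, sum_law_left]
      _ ≤ ∑ w : β × γ, law p (fun ω => (V ω, Z ω)) w := by
          refine Finset.sum_le_sum fun w _ => ?_
          have h4 := law_nonneg hp (fun ω => (V ω, Z ω)) w
          rcases eq_or_ne (law p Z w.2) 0 with h | h
          · simpa [h] using h4
          · rw [mul_div_cancel_left₀ _ h]
      _ = 1 := by rw [sum_law, hp1]

theorem mutualInfo_nonneg {p : Ω → ℝ} (hp : ∀ ω, 0 ≤ p ω) (hp1 : ∑ ω, p ω = 1)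
    (U : Ω → α) (V : Ω → β) : 0 ≤ mutualInfo p U V := by
  rw [mutualInfo_eq_condMutualInfo p hp1]; exact condMutualInfo_nonneg hp hp1 _ _ _

/-- Chain rule `I(U, Z; V) = I(Z; V) + I(U; V | Z)`. -/
theorem mutualInfo_chain {p : Ω → ℝ} (hp : ∀ ω, 0 ≤ p ω) (U : Ω → α) (V : Ω → β) (Z : Ω → γ) :
    mutualInfo p (fun ω => (U ω, Z ω)) V = mutualInfo p Z V + condMutualInfo p U V Z := by
  simp only [mutualInfo_eq_sum, condMutualInfo_eq_sum, ← Finset.sum_add_distrib]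
  refine Finset.sum_congr rfl fun ω _ => ?_
  rcases (hp ω).eq_or_lt with h | h
  · simp [← h]
  have e1 : law p (fun ω => ((U ω, Z ω), V ω)) ((U ω, Z ω), V ω) =
      law p (fun ω => (U ω, V ω, Z ω)) (U ω, V ω, Z ω) :=
    law_congr p _ (fun ω => (U ω, V ω, Z ω)) ω (by simp; tauto)
  have e2 : law p (fun ω => (Z ω, V ω)) (Z ω, V ω) =
      law p (fun ω => (V ω, Z ω)) (V ω, Z ω) :=
    law_congr p _ (fun ω => (V ω, Z ω)) ω (by simp; tauto)
  rw [e1, e2]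
  have h1 := law_pos hp (fun ω => (U ω, V ω, Z ω)) h
  have h2 := law_pos hp Z h
  have h3 := law_pos hp (fun ω => (U ω, Z ω)) h
  have h4 := law_pos hp (fun ω => (V ω, Z ω)) h
  have h5 := law_pos hp V h
  rw [← mul_add, ← Real.logb_mul (by positivity) (by positivity)]
  congr 2
  field_simp

/-- Chain rule `I(U; T, V | Z) = I(U; V | Z) + I(U; T | Z, V)`. -/
theorem condMutualInfo_chain {p : Ω → ℝ} (hp : ∀ ω, 0 ≤ p ω)
    (U : Ω → α) (T : Ω → δ) (V : Ω → β) (Z : Ω → γ) :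
    condMutualInfo p U (fun ω => (T ω, V ω)) Z =
      condMutualInfo p U V Z + condMutualInfo p U T (fun ω => (Z ω, V ω)) := by
  simp only [condMutualInfo_eq_sum, ← Finset.sum_add_distrib]
  refine Finset.sum_congr rfl fun ω _ => ?_
  rcases (hp ω).eq_or_lt with h | h
  · simp [← h]
  have e1 : law p (fun ω => (U ω, (T ω, V ω), Z ω)) (U ω, (T ω, V ω), Z ω) =
      law p (fun ω => (U ω, T ω, Z ω, V ω)) (U ω, T ω, Z ω, V ω) :=
    law_congr p _ (fun ω => (U ω, T ω, Z ω, V ω)) ω (by simp; tauto)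
  have e2 : law p (fun ω => ((T ω, V ω), Z ω)) ((T ω, V ω), Z ω) =
      law p (fun ω => (T ω, Z ω, V ω)) (T ω, Z ω, V ω) :=
    law_congr p _ (fun ω => (T ω, Z ω, V ω)) ω (by simp; tauto)
  have e3 : law p (fun ω => (U ω, Z ω, V ω)) (U ω, Z ω, V ω) =
      law p (fun ω => (U ω, V ω, Z ω)) (U ω, V ω, Z ω) :=
    law_congr p _ (fun ω => (U ω, V ω, Z ω)) ω (by simp; tauto)
  have e4 : law p (fun ω => (Z ω, V ω)) (Z ω, V ω) =
      law p (fun ω => (V ω, Z ω)) (V ω, Z ω) :=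
    law_congr p _ (fun ω => (V ω, Z ω)) ω (by simp; tauto)
  rw [e1, e2, e3, e4]
  have h1 := law_pos hp (fun ω => (U ω, T ω, Z ω, V ω)) h
  have h2 := law_pos hp Z h
  have h3 := law_pos hp (fun ω => (T ω, Z ω, V ω)) h
  have h4 := law_pos hp (fun ω => (V ω, Z ω)) h
  have h5 := law_pos hp (fun ω => (U ω, Z ω)) h
  have h6 := law_pos hp (fun ω => (U ω, V ω, Z ω)) h
  rw [← mul_add, ← Real.logb_mul (by positivity) (by positivity)]
  congr 2
  field_simp

/-- Minus the Shannon entropy of `U`, in bits: `-H(U)`. -/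
noncomputable def negEntropy (p : Ω → ℝ) (U : Ω → α) : ℝ := ∑ u, law p U u * Real.logb 2 (law p U u)

theorem negEntropy_eq_sum (p : Ω → ℝ) (U : Ω → α) :
    negEntropy p U = ∑ ω, p ω * Real.logb 2 (law p U (U ω)) :=
  sum_law_mul p U fun u => Real.logb 2 (law p U u)

theorem condMutualInfo_eq_negEntropy {p : Ω → ℝ} (hp : ∀ ω, 0 ≤ p ω)
    (U : Ω → α) (V : Ω → β) (Z : Ω → γ) :
    condMutualInfo p U V Z = negEntropy p (fun ω => (U ω, V ω, Z ω)) + negEntropy p Z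
      - (negEntropy p (fun ω => (U ω, Z ω)) + negEntropy p (fun ω => (V ω, Z ω))) := by
  simp only [condMutualInfo_eq_sum, negEntropy_eq_sum, ← Finset.sum_add_distrib,
    ← Finset.sum_sub_distrib]
  refine Finset.sum_congr rfl fun ω _ => ?_
  rcases (hp ω).eq_or_lt with h | h
  · simp [← h]
  have h1 := law_pos hp (fun ω => (U ω, V ω, Z ω)) h
  have h2 := law_pos hp Z h
  have h3 := law_pos hp (fun ω => (U ω, Z ω)) h
  have h4 := law_pos hp (fun ω => (V ω, Z ω)) h
  rw [Real.logb_div (by positivity) (by positivity), Real.logb_mul h1.ne' h2.ne',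
    Real.logb_mul h3.ne' h4.ne']
  ring

theorem continuous_negEntropy {T : Type*} [TopologicalSpace T] {p : T → Ω → ℝ}
    (hp : Continuous p) (U : Ω → α) : Continuous fun t => negEntropy (p t) U := by
  classical
  have hlaw : ∀ u, Continuous fun t => law (p t) U u := fun u =>
    continuous_finsetSum _ fun ω _ => by
      split_ifs
      · exact (continuous_apply ω).comp hp
      · exact continuous_const
  refine continuous_finsetSum _ fun u _ => ?_
  have : (fun t => law (p t) U u * Real.logb 2 (law (p t) U u)) =
      fun t => (law (p t) U u * Real.log (law (p t) U u)) / Real.log 2 := by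
    funext t; rw [Real.logb, mul_div_assoc]
  rw [this]
  exact (Real.continuous_mul_log.comp (hlaw u)).div_const _

/-- Conditional mutual information is continuous on the set of probability mass functions:
written through entropies, it only involves the continuous function `t log t`. -/
theorem continuousOn_condMutualInfo {T : Type*} [TopologicalSpace T] {p : T → Ω → ℝ}
    (hp : Continuous p) {K : Set T} (hK : ∀ t ∈ K, ∀ ω, 0 ≤ p t ω)
    (U : Ω → α) (V : Ω → β) (Z : Ω → γ) :
    ContinuousOn (fun t => condMutualInfo (p t) U V Z) K := by
  have h : Continuous fun t => negEntropy (p t) (fun ω => (U ω, V ω, Z ω)) + negEntropy (p t) Z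
      - (negEntropy (p t) (fun ω => (U ω, Z ω)) + negEntropy (p t) (fun ω => (V ω, Z ω))) :=
    ((continuous_negEntropy hp _).add (continuous_negEntropy hp _)).sub
      ((continuous_negEntropy hp _).add (continuous_negEntropy hp _))
  exact h.continuousOn.congr fun t ht => condMutualInfo_eq_negEntropy (hK t ht) U V Z

end Info

/-! ### Product distributions -/

section Product

variable {S : Type*} [Fintype S] {n : ℕ}

theorem sum_prod_pi (f : Fin n → S → ℝ) :
    ∑ σ : Fin n → S, ∏ i, f i (σ i) = ∏ i, ∑ s, f i s := by
  classical
  rw [Finset.prod_univ_sum, Fintype.piFinset_univ]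

theorem sum_prod_eq_one {P : S → ℝ} (hP1 : ∑ s, P s = 1) :
    ∑ σ : Fin n → S, ∏ i, P (σ i) = 1 := by
  rw [sum_prod_pi (fun _ => P)]; simp [hP1]

/-- Each coordinate of an i.i.d. sequence has the given law. -/
theorem sum_prod_mul_coord {P : S → ℝ} (hP1 : ∑ s, P s = 1) (i : Fin n) (F : S → ℝ) :
    ∑ σ : Fin n → S, (∏ j, P (σ j)) * F (σ i) = ∑ s, P s * F s := by
  classical
  calc _ = ∑ σ : Fin n → S, ∏ j, (P (σ j) * if j = i then F (σ j) else 1) := by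
        refine Finset.sum_congr rfl fun σ _ => ?_
        rw [Finset.prod_mul_distrib, Finset.prod_ite_eq' Finset.univ i]; simp
    _ = ∏ j, if j = i then ∑ s, P s * F s else 1 := by
        rw [sum_prod_pi (fun j s => P s * if j = i then F s else 1)]
        refine Finset.prod_congr rfl fun j _ => ?_
        split_ifs <;> simp [hP1]
    _ = _ := by simp

end Product

/-! ### Converse -/

section Converse

variable {S C V : Type*} [Fintype S] [Fintype C]

/-- The source model in which the side information is i.i.d. with law `r`, and the source letters are
drawn from `k (· | v)` on the fibre of the side information, where the sequence `v = g c` may depend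
on the whole side information `c`, has total mass at most one. -/
theorem sum_prod_kernel_le_one {n : ℕ} (h : S → C) {r : C → ℝ} {k : S → V → ℝ}
    (hr : ∀ c, 0 ≤ r c) (hr1 : ∑ c, r c = 1) (hk : ∀ s v, 0 ≤ k s v)
    (hk1 : ∀ c v, ∑ s, (open Classical in if h s = c then k s v else 0) ≤ 1)
    (g : (Fin n → C) → Fin n → V) :
    ∑ σ : Fin n → S, ∏ i, (r (h (σ i)) * k (σ i) (g (fun j => h (σ j)) i)) ≤ 1 := by
  classical
  calc _ = ∑ σ : Fin n → S, ∑ c : Fin n → C,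
          ∏ i, (if h (σ i) = c i then r (c i) * k (σ i) (g c i) else 0) := by
        refine Finset.sum_congr rfl fun σ _ => ?_
        rw [Finset.sum_eq_single fun j => h (σ j)]
        · simp
        · intro c _ hc
          obtain ⟨i, hi⟩ := Function.ne_iff.1 hc
          exact Finset.prod_eq_zero (Finset.mem_univ i) (if_neg (Ne.symm hi))
        · simp
    _ = ∑ c : Fin n → C, ∏ i, (r (c i) * ∑ s, if h s = c i then k s (g c i) else 0) := by
        rw [Finset.sum_comm]
        refine Finset.sum_congr rfl fun c _ => ?_
        rw [sum_prod_pi (fun i s => if h s = c i then r (c i) * k s (g c i) else 0)]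
        refine Finset.prod_congr rfl fun i _ => ?_
        rw [Finset.mul_sum]
        exact Finset.sum_congr rfl fun s _ => by split_ifs <;> simp
    _ ≤ ∑ c : Fin n → C, ∏ i, r (c i) := by
        refine Finset.sum_le_sum fun c _ => Finset.prod_le_prod (fun i _ => ?_) fun i _ => ?_
        · exact mul_nonneg (hr _) (Finset.sum_nonneg fun s _ => by split_ifs <;> simp [hk])
        · refine mul_le_of_le_one_right (hr _) (le_trans (le_of_eq ?_) (hk1 (c i) (g c i)))
          exact Finset.sum_congr rfl fun s _ => by congr
    _ = 1 := sum_prod_eq_one hr1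

/-- A description in `Fin M` of an i.i.d. sequence `σ`, decoded with side information `h σ`, cannot
raise the likelihood of the source by more than a factor `M`: for every source model
`r c * k s v` with `k (· | v)` a kernel on the fibres of the side information, the expected
log-likelihood ratio is at most `log M`. -/
theorem sum_logb_ratio_le {n M : ℕ} {P : S → ℝ} (hP : ∀ s, 0 ≤ P s) (hP1 : ∑ s, P s = 1)
    (h : S → C) {r : C → ℝ} {k : S → V → ℝ}
    (hr : ∀ c, 0 ≤ r c) (hr1 : ∑ c, r c = 1) (hk : ∀ s v, 0 ≤ k s v)
    (hk1 : ∀ c v, ∑ s, (open Classical in if h s = c then k s v else 0) ≤ 1)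
    (t : (Fin n → S) → Fin M) (g : (Fin n → C) → Fin M → Fin n → V) (v : (Fin n → S) → Fin n → V)
    (hv : ∀ σ, v σ = g (fun j => h (σ j)) (t σ))
    (hpos : ∀ σ : Fin n → S, 0 < ∏ i, P (σ i) → ∀ i, 0 < r (h (σ i)) * k (σ i) (v σ i)) :
    ∑ σ : Fin n → S, (∏ i, P (σ i)) *
      ∑ i, Real.logb 2 (r (h (σ i)) * k (σ i) (v σ i) / P (σ i)) ≤ Real.logb 2 M := by
  classical
  have hPn : ∀ σ : Fin n → S, 0 ≤ ∏ i, P (σ i) := fun σ => Finset.prod_nonneg fun i _ => hP _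
  have hM : 0 < (M : ℝ) := by
    have : Nonempty (Fin n → S) := by
      by_contra hne
      rw [not_nonempty_iff] at hne
      have := sum_prod_eq_one (n := n) hP1
      simp at this
    obtain ⟨σ⟩ := this
    exact_mod_cast (Fin.pos (t σ))
  set N : (Fin n → S) → ℝ := fun σ => ∏ i, (r (h (σ i)) * k (σ i) (v σ i)) with hN
  have hN0 : ∀ σ, 0 ≤ N σ := fun σ => Finset.prod_nonneg fun i _ => mul_nonneg (hr _) (hk _ _)
  -- Jensen's inequality for the logarithm, in the form `log z ≤ z / M - 1 + log M`
  have key : ∀ σ : Fin n → S, (∏ i, P (σ i)) *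
      ∑ i, Real.log (r (h (σ i)) * k (σ i) (v σ i) / P (σ i)) ≤
      N σ / M + (∏ i, P (σ i)) * (Real.log M - 1) := by
    intro σ
    rcases (hPn σ).eq_or_lt with h0 | h0
    · rw [← h0]; have := hN0 σ; simp; positivity
    have hPi : ∀ i, 0 < P (σ i) := fun i => (hP _).lt_of_ne fun hi =>
      h0.ne' (Finset.prod_eq_zero (Finset.mem_univ i) hi.symm)
    have hi := hpos σ h0
    have hNp : 0 < N σ := Finset.prod_pos fun i _ => hi i
    rw [← Real.log_prod (fun i _ => (div_pos (hi i) (hPi i)).ne'), Finset.prod_div_distrib]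
    have h1 := Real.log_le_sub_one_of_pos (div_pos (div_pos hNp h0) hM)
    rw [Real.log_div (div_pos hNp h0).ne' hM.ne'] at h1
    have h2 : N σ / M = (∏ i, P (σ i)) * (N σ / (∏ i, P (σ i)) / M) := by field_simp
    rw [h2, ← mul_add]
    exact mul_le_mul_of_nonneg_left (by linarith) h0.le
  have hsum : ∑ σ, N σ ≤ M := by
    calc ∑ σ, N σ ≤ ∑ σ : Fin n → S, ∑ m : Fin M,
          ∏ i, (r (h (σ i)) * k (σ i) (g (fun j => h (σ j)) m i)) := by
          refine Finset.sum_le_sum fun σ _ => ?_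
          refine le_trans (le_of_eq ?_) (Finset.single_le_sum (fun m _ =>
            Finset.prod_nonneg fun i _ => mul_nonneg (hr _) (hk _ _)) (Finset.mem_univ (t σ)))
          simp only [hN, hv]
      _ ≤ ∑ m : Fin M, (1 : ℝ) := by
          rw [Finset.sum_comm]
          exact Finset.sum_le_sum fun m _ =>
            sum_prod_kernel_le_one h hr hr1 hk hk1 (fun c => g c m)
      _ = M := by simp
  have hlog2 : 0 < Real.log 2 := Real.log_pos (by norm_num)
  have h3 := Finset.sum_le_sum fun σ (_ : σ ∈ Finset.univ) => key σ
  rw [Finset.sum_add_distrib, ← Finset.sum_div, ← Finset.sum_mul, sum_prod_eq_one hP1] at h3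
  have h4 : (∑ σ, N σ) / M ≤ 1 := (div_le_one hM).2 hsum
  have h5 : ∑ σ : Fin n → S, (∏ i, P (σ i)) *
      ∑ i, Real.logb 2 (r (h (σ i)) * k (σ i) (v σ i) / P (σ i)) =
      (∑ σ : Fin n → S, (∏ i, P (σ i)) *
        ∑ i, Real.log (r (h (σ i)) * k (σ i) (v σ i) / P (σ i))) / Real.log 2 := by
    rw [Finset.sum_div]
    refine Finset.sum_congr rfl fun σ _ => ?_
    simp only [Real.logb, ← Finset.sum_div, mul_div_assoc]
  rw [h5, Real.logb]
  gcongr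
  linarith

end Converse

/-- Every probability mass function on quadruples with source marginal `P` is of the form
`joint P W`. -/
theorem exists_joint_eq {X Y Xh1 Xh2 : Type*} [Fintype Xh1] [Fintype Xh2] {P : X × Y → ℝ} [Nonempty (Xh1 × Xh2)]
    {q : X × Y × Xh1 × Xh2 → ℝ} (hq : ∀ ω, 0 ≤ q ω)
    (hqP : ∀ x y, ∑ v : Xh1 × Xh2, q (x, y, v) = P (x, y)) :
    ∃ W : X × Y → Xh1 × Xh2 → ℝ, (∀ s, W s ∈ stdSimplex ℝ (Xh1 × Xh2)) ∧ joint P W = q := by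
  classical
  obtain ⟨v₀⟩ := ‹Nonempty (Xh1 × Xh2)›
  refine ⟨fun s v => if P s = 0 then (Pi.single v₀ 1 : Xh1 × Xh2 → ℝ) v else q (s.1, s.2, v) / P s, ?_, ?_⟩
  · rintro ⟨x, y⟩
    by_cases h : P (x, y) = 0
    · simp only [h, if_true]
      exact single_mem_stdSimplex ℝ v₀
    · simp only [h, if_false]
      refine ⟨fun v => div_nonneg (hq _) ?_, ?_⟩
      · rw [← hqP]; exact Finset.sum_nonneg fun _ _ => hq _
      · rw [← Finset.sum_div, hqP, div_self h]
  · funext ⟨x, y, v⟩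
    by_cases h : P (x, y) = 0
    · have := (Finset.sum_eq_zero_iff_of_nonneg fun v _ => hq (x, y, v)).1 ((hqP x y).trans h) v
        (Finset.mem_univ v)
      simp [joint, h, this]
    · simp only [joint, h, if_false]
      field_simp

section CodeConverse

variable {X Y Xh1 Xh2 : Type*} [Fintype X] [Fintype Y]

theorem expectIID_eq (P : X × Y → ℝ) {n : ℕ} (φ : (Fin n → X) → (Fin n → Y) → ℝ) :
    expectIID P φ = ∑ σ : Fin n → X × Y, (∏ i, P (σ i)) *
      φ (fun i => (σ i).1) (fun i => (σ i).2) := by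
  rw [expectIID, ← Fintype.sum_prod_type']
  exact (Fintype.sum_equiv (Equiv.arrowProdEquivProdArrow (Fin n) (fun _ => X) (fun _ => Y)) _ _
    (fun σ => rfl)).symm

variable [Fintype Xh1] [Fintype Xh2]

theorem joint_nonneg {P : X × Y → ℝ} (hP : P ∈ stdSimplex ℝ (X × Y))
    {W : X × Y → Xh1 × Xh2 → ℝ} (hW : ∀ s, W s ∈ stdSimplex ℝ (Xh1 × Xh2))
    (ω : X × Y × Xh1 × Xh2) : 0 ≤ joint P W ω := mul_nonneg (hP.1 _) ((hW _).1 _)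

theorem law_joint_source {P : X × Y → ℝ}
    {W : X × Y → Xh1 × Xh2 → ℝ} (hW : ∀ s, W s ∈ stdSimplex ℝ (Xh1 × Xh2)) (s : X × Y) :
    law (joint P W) (fun ω : X × Y × Xh1 × Xh2 => (ω.1, ω.2.1)) s = P s := by
  classical
  obtain ⟨x, y⟩ := s
  have h : ∀ x y, ∑ a, ∑ b, P (x, y) * W (x, y) (a, b) = P (x, y) := fun x y => by
    simp only [← Finset.mul_sum]
    rw [← Fintype.sum_prod_type (fun ab : Xh1 × Xh2 => W (x, y) ab), (hW (x, y)).2, mul_one]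
  simp only [law, joint, Fintype.sum_prod_type]
  rw [Finset.sum_eq_single x, Finset.sum_eq_single y]
  · simpa using h x y
  · intro y' _ hy; simp [hy]
  · simp
  · intro x' _ hx; simp [hx]
  · simp

theorem sum_joint {P : X × Y → ℝ} (hP : P ∈ stdSimplex ℝ (X × Y))
    {W : X × Y → Xh1 × Xh2 → ℝ} (hW : ∀ s, W s ∈ stdSimplex ℝ (Xh1 × Xh2)) :
    ∑ ω, joint P W ω = 1 := by
  rw [← sum_law _ (fun ω : X × Y × Xh1 × Xh2 => (ω.1, ω.2.1))]
  simp only [law_joint_source hW, hP.2]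

/-- Single-letterization: the joint law of source and reconstructions at a uniformly distributed
time of a block code satisfies the information constraints with the rates of the code. -/
theorem Code.exists_channel {P : X × Y → ℝ} (hP : P ∈ stdSimplex ℝ (X × Y))
    (d1 : X → Xh1 → ℝ) (d2 : X → Xh2 → ℝ) {n M1 M2 : ℕ} (hn : 0 < n)
    (c : Code X Y Xh1 Xh2 n M1 M2) {D1 D2 : ℝ} (hc : c.MeetsDistortion P d1 d2 D1 D2) :
    ∃ W : X × Y → Xh1 × Xh2 → ℝ, (∀ s, W s ∈ stdSimplex ℝ (Xh1 × Xh2)) ∧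
      (∑ ω : X × Y × Xh1 × Xh2, joint P W ω * d1 ω.1 ω.2.2.1) ≤ D1 ∧
      (∑ ω : X × Y × Xh1 × Xh2, joint P W ω * d2 ω.1 ω.2.2.2) ≤ D2 ∧
      n * mutualInfo (joint P W)
        (fun ω : X × Y × Xh1 × Xh2 => (ω.1, ω.2.1)) (fun ω => ω.2.2.2) ≤ Real.logb 2 M2 ∧
      n * condMutualInfo (joint P W)
        (fun ω : X × Y × Xh1 × Xh2 => ω.1) (fun ω => ω.2.2) (fun ω => ω.2.1) ≤
          Real.logb 2 M1 := by
  classical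
  have hn' : (0 : ℝ) < n := by exact_mod_cast hn
  set A : (Fin n → X × Y) → Fin n → Xh1 :=
    fun σ => c.recon1 (fun i => (σ i).1) (fun i => (σ i).2) with hA
  set B : (Fin n → X × Y) → Fin n → Xh2 :=
    fun σ => c.recon2 (fun i => (σ i).1) (fun i => (σ i).2) with hB
  set p : Fin n × (Fin n → X × Y) → ℝ := fun ω => (1 / n) * ∏ j, P (ω.2 j) with hp
  set Q : Fin n × (Fin n → X × Y) → X × Y × Xh1 × Xh2 :=
    fun ω => ((ω.2 ω.1).1, (ω.2 ω.1).2, A ω.2 ω.1, B ω.2 ω.1) with hQ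
  have hp0 : ∀ ω, 0 ≤ p ω := fun ω =>
    mul_nonneg (by positivity) (Finset.prod_nonneg fun _ _ => hP.1 _)
  have hq0 : ∀ ω, 0 ≤ law p Q ω := law_nonneg hp0 Q
  -- expectations under the law at a uniform time
  have hE : ∀ F : X × Y × Xh1 × Xh2 → ℝ, n * ∑ ω, law p Q ω * F ω =
      ∑ σ : Fin n → X × Y, (∏ j, P (σ j)) * ∑ i, F (σ i |>.1, (σ i).2, A σ i, B σ i) := by
    intro F
    rw [sum_law_mul, Fintype.sum_prod_type, Finset.sum_comm, Finset.mul_sum]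
    refine Finset.sum_congr rfl fun σ _ => ?_
    rw [Finset.mul_sum, Finset.mul_sum]
    refine Finset.sum_congr rfl fun i _ => ?_
    simp only [hp, hQ]
    field_simp
  have hqP : ∀ x y, ∑ v : Xh1 × Xh2, law p Q (x, y, v) = P (x, y) := by
    intro x y
    have h1 := hE fun ω => if ω.1 = x ∧ ω.2.1 = y then 1 else 0
    have h2 : ∑ ω, law p Q ω * (if ω.1 = x ∧ ω.2.1 = y then 1 else 0) =
        ∑ v : Xh1 × Xh2, law p Q (x, y, v) := by
      rw [Fintype.sum_prod_type, Finset.sum_eq_single x, Fintype.sum_prod_type,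
        Finset.sum_eq_single y]
      · simp
      · intro y' _ hy; simp [hy]
      · simp
      · intro x' _ hx; simp [hx]
      · simp
    rw [h2] at h1
    have h3 : ∑ σ : Fin n → X × Y, (∏ j, P (σ j)) *
        ∑ i, (if (σ i).1 = x ∧ (σ i).2 = y then (1 : ℝ) else 0) = n * P (x, y) := by
      simp only [Finset.mul_sum]
      rw [Finset.sum_comm]
      have : ∀ i : Fin n, ∑ σ : Fin n → X × Y, (∏ j, P (σ j)) *
          (if (σ i).1 = x ∧ (σ i).2 = y then (1 : ℝ) else 0) = P (x, y) := fun i => by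
        rw [sum_prod_mul_coord hP.2 i fun s => if s.1 = x ∧ s.2 = y then (1 : ℝ) else 0,
          Finset.sum_eq_single (x, y)]
        · simp
        · rintro ⟨x', y'⟩ _ hne
          have : ¬ (x' = x ∧ y' = y) := fun h => hne (by rw [h.1, h.2])
          simp [this]
        · simp
      rw [Finset.sum_congr rfl fun i _ => this i]
      simp
    exact mul_left_cancel₀ hn'.ne' (h1.trans h3)
  have hne : Nonempty (Xh1 × Xh2) := by
    have : Nonempty (X × Y) := by
      by_contra h
      rw [not_nonempty_iff] at h
      simpa using hP.2
    obtain ⟨s⟩ := this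
    exact ⟨A (fun _ => s) ⟨0, hn⟩, B (fun _ => s) ⟨0, hn⟩⟩
  obtain ⟨W, hW, hWq⟩ := exists_joint_eq hq0 hqP
  have hsrc : ∀ s, law (law p Q) (fun ω : X × Y × Xh1 × Xh2 => (ω.1, ω.2.1)) s = P s := fun s => by
    rw [← hWq]; exact law_joint_source hW s
  have hqpos : ∀ σ : Fin n → X × Y, 0 < ∏ j, P (σ j) → ∀ i,
      0 < law p Q ((σ i).1, (σ i).2, A σ i, B σ i) := fun σ h i =>
    law_pos hp0 Q (ω := (i, σ)) (mul_pos (by positivity) h)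
  refine ⟨W, hW, ?_, ?_, ?_, ?_⟩
  · rw [hWq]
    refine le_trans (le_of_eq ?_) hc.1
    refine mul_left_cancel₀ hn'.ne' ((hE fun ω => d1 ω.1 ω.2.2.1).trans ?_)
    rw [expectIID_eq, Finset.mul_sum]
    refine Finset.sum_congr rfl fun σ _ => ?_
    simp only [seqDist]
    field_simp
    rfl
  · rw [hWq]
    refine le_trans (le_of_eq ?_) hc.2
    refine mul_left_cancel₀ hn'.ne' ((hE fun ω => d2 ω.1 ω.2.2.2).trans ?_)
    rw [expectIID_eq, Finset.mul_sum]
    refine Finset.sum_congr rfl fun σ _ => ?_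
    simp only [seqDist]
    field_simp
    rfl
  · -- no side information at User 2; the source model is the backward channel given `x̂₂`
    rw [hWq, mutualInfo_eq_sum, hE fun ω => Real.logb 2 _]
    have := sum_logb_ratio_le (n := n) (M := M2) hP.1 hP.2 (fun _ => ()) (r := fun _ => 1)
      (k := fun s b => law (law p Q) (fun ω => ((ω.1, ω.2.1), ω.2.2.2)) (s, b) /
        law (law p Q) (fun ω => ω.2.2.2) b) (by simp) (by simp)
      (fun s b => div_nonneg (law_nonneg hq0 _ _) (law_nonneg hq0 _ _)) ?_
      (fun σ => c.f2 (fun i => (σ i).2) (c.f1 (fun i => (σ i).1) (fun i => (σ i).2)))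
      (fun _ m => c.g2 m) B (fun σ => rfl) ?_
    · refine le_trans (le_of_eq ?_) this
      refine Finset.sum_congr rfl fun σ _ => ?_
      congr 1
      refine Finset.sum_congr rfl fun i _ => ?_
      simp only [hsrc]
      rw [one_mul, div_div, mul_comm (P (σ i))]
    · intro _ b
      simp only [if_true]
      rw [← Finset.sum_div, sum_law_left (law p Q) (fun ω => (ω.1, ω.2.1)) (fun ω => ω.2.2.2)]
      exact div_self_le_one _
    · intro σ hσ i
      rw [one_mul]
      exact div_pos (law_pos hq0 (fun ω => ((ω.1, ω.2.1), ω.2.2.2)) (hqpos σ hσ i))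
        (law_pos hq0 (fun ω => ω.2.2.2) (hqpos σ hσ i))
  · rw [hWq, condMutualInfo_eq_sum, hE fun ω => Real.logb 2 _]
    have := sum_logb_ratio_le (n := n) (M := M1) hP.1 hP.2 Prod.snd
      (r := law (law p Q) fun ω => ω.2.1)
      (k := fun s v => law (law p Q) (fun ω => (ω.1, ω.2.2, ω.2.1)) (s.1, v, s.2) /
        law (law p Q) (fun ω => (ω.2.2, ω.2.1)) (v, s.2)) (law_nonneg hq0 _) ?_
      (fun s b => div_nonneg (law_nonneg hq0 _ _) (law_nonneg hq0 _ _)) ?_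
      (fun σ => c.f1 (fun i => (σ i).1) (fun i => (σ i).2))
      (fun y m i => (c.g1 y m i, c.g2 (c.f2 y m) i)) (fun σ i => (A σ i, B σ i))
      (fun σ => rfl) ?_
    · refine le_trans (le_of_eq ?_) this
      refine Finset.sum_congr rfl fun σ _ => ?_
      congr 1
      refine Finset.sum_congr rfl fun i _ => ?_
      simp only [hsrc]
      congr 1
      rw [← mul_div_assoc, div_div]
      congr 1 <;> ring
    · rw [sum_law, ← hWq, sum_joint hP hW]
    · intro y v
      rw [Fintype.sum_prod_type]
      have : ∀ x, ∑ y', (if y' = y then law (law p Q) (fun ω => (ω.1, ω.2.2, ω.2.1)) (x, v, y') /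
          law (law p Q) (fun ω => (ω.2.2, ω.2.1)) (v, y') else 0) =
          law (law p Q) (fun ω => (ω.1, ω.2.2, ω.2.1)) (x, v, y) /
          law (law p Q) (fun ω => (ω.2.2, ω.2.1)) (v, y) := fun x => by simp
      refine le_trans (le_of_eq (Finset.sum_congr rfl fun x _ =>
        (Finset.sum_congr rfl fun y' _ => ?_).trans (this x))) ?_
      · congr
      rw [← Finset.sum_div, sum_law_left (law p Q) (fun ω => ω.1) (fun ω => (ω.2.2, ω.2.1))]
      exact div_self_le_one _
    · intro σ hσ i
      exact mul_pos (law_pos hq0 (fun ω => ω.2.1) (hqpos σ hσ i))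
        (div_pos (law_pos hq0 (fun ω => (ω.1, ω.2.2, ω.2.1)) (hqpos σ hσ i))
        (law_pos hq0 (fun ω => (ω.2.2, ω.2.1)) (hqpos σ hσ i)))

/-- On a compact set, finitely many continuous constraints that can be met up to every `ε > 0` can
be met exactly. -/
theorem _root_.IsCompact.exists_forall_le_of_forall_pos {T J : Type*} [TopologicalSpace T]
    [Fintype J] [Nonempty J] {K : Set T} (hK : IsCompact K) {f : J → T → ℝ} {b : J → ℝ}
    (hf : ∀ j, ContinuousOn (f j) K) (h : ∀ ε > 0, ∃ t ∈ K, ∀ j, f j t ≤ b j + ε) :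
    ∃ t ∈ K, ∀ j, f j t ≤ b j := by
  have hne : K.Nonempty := by
    obtain ⟨t, ht, _⟩ := h 1 one_pos
    exact ⟨t, ht⟩
  have hu : (Finset.univ : Finset J).Nonempty := Finset.univ_nonempty
  -- minimise the largest excess over the bounds
  have hcont : ContinuousOn (fun t => Finset.univ.sup' hu fun j => f j t - b j) K :=
    ContinuousOn.finset_sup'_apply hu fun j _ => (hf j).sub continuousOn_const
  obtain ⟨t, ht, hmin⟩ := hK.exists_isMinOn hne hcont
  refine ⟨t, ht, fun j => ?_⟩
  refine le_of_forall_pos_le_add fun ε hε => ?_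
  obtain ⟨t', ht', h'⟩ := h ε hε
  have h1 := isMinOn_iff.1 hmin t' ht'
  have h2 := Finset.le_sup' (fun j => f j t - b j) (Finset.mem_univ j)
  have h3 : Finset.univ.sup' hu (fun j => f j t' - b j) ≤ ε :=
    Finset.sup'_le hu _ fun j _ => by linarith [h' j]
  linarith

theorem operationalRegion_subset {P : X × Y → ℝ} (hP : P ∈ stdSimplex ℝ (X × Y))
    (d1 : X → Xh1 → ℝ) (d2 : X → Xh2 → ℝ) (D1 D2 : ℝ) :
    operationalRegion P d1 d2 D1 D2 ⊆ singleLetterRegion P d1 d2 D1 D2 := by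
  intro R hR
  set K : Set (X × Y → Xh1 × Xh2 → ℝ) := Set.pi Set.univ fun _ => stdSimplex ℝ (Xh1 × Xh2)
  have hK : IsCompact K := isCompact_univ_pi fun _ => isCompact_stdSimplex ℝ _
  have hKW : ∀ W ∈ K, ∀ s, W s ∈ stdSimplex ℝ (Xh1 × Xh2) := fun W h s => h s (Set.mem_univ s)
  have hcj : Continuous fun W : X × Y → Xh1 × Xh2 → ℝ => joint P W := by
    unfold joint; fun_prop
  have hc0 : ∀ W ∈ K, ∀ ω, 0 ≤ joint P W ω := fun W h => joint_nonneg hP (hKW W h)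
  let f : Fin 4 → (X × Y → Xh1 × Xh2 → ℝ) → ℝ :=
    ![fun W => ∑ ω : X × Y × Xh1 × Xh2, joint P W ω * d1 ω.1 ω.2.2.1,
      fun W => ∑ ω : X × Y × Xh1 × Xh2, joint P W ω * d2 ω.1 ω.2.2.2,
      fun W => mutualInfo (joint P W)
        (fun ω : X × Y × Xh1 × Xh2 => (ω.1, ω.2.1)) (fun ω => ω.2.2.2),
      fun W => condMutualInfo (joint P W)
        (fun ω : X × Y × Xh1 × Xh2 => ω.1) (fun ω => ω.2.2) (fun ω => ω.2.1)]
  let b : Fin 4 → ℝ := ![D1, D2, R.2, R.1]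
  suffices h : ∃ W ∈ K, ∀ j, f j W ≤ b j by
    obtain ⟨W, hW, h⟩ := h
    exact ⟨W, hKW W hW, h 0, h 1, h 2, h 3⟩
  refine hK.exists_forall_le_of_forall_pos ?_ ?_
  · have hd : ∀ F : X × Y × Xh1 × Xh2 → ℝ, ContinuousOn (fun W => ∑ ω, joint P W ω * F ω) K :=
      fun F => (continuous_finsetSum _ fun ω _ =>
        ((continuous_apply ω).comp hcj).mul continuous_const).continuousOn
    intro j
    fin_cases j
    · exact hd fun ω => d1 ω.1 ω.2.2.1
    · exact hd fun ω => d2 ω.1 ω.2.2.2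
    · exact (continuousOn_condMutualInfo hcj hc0 _ _ _).congr fun W hW =>
        mutualInfo_eq_condMutualInfo _ (sum_joint hP (hKW W hW)) _ _
    · exact continuousOn_condMutualInfo hcj hc0 _ _ _
  · intro ε hε
    obtain ⟨R', hR', hdist⟩ := Metric.mem_closure_iff.1 hR ε hε
    obtain ⟨N, hN⟩ := hR' ε hε
    obtain ⟨c, hc⟩ := hN (max N 1) (le_max_left _ _)
    have hn : 0 < max N 1 := lt_of_lt_of_le one_pos (le_max_right _ _)
    obtain ⟨W, hW, h1, h2, h3, h4⟩ := c.exists_channel hP d1 d2 hn hc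
    have hn' : (0 : ℝ) < (max N 1 : ℕ) := by exact_mod_cast hn
    generalize max N 1 = n at *
    obtain ⟨s⟩ : Nonempty (X × Y) := by
      by_contra h
      rw [not_nonempty_iff] at h
      simpa using hP.2
    have hrate : ∀ (r : ℝ), 0 < ⌊(2 : ℝ) ^ ((n : ℝ) * r)⌋₊ →
        Real.logb 2 (⌊(2 : ℝ) ^ ((n : ℝ) * r)⌋₊ : ℝ) ≤ n * r := fun r hr => by
      rw [Real.logb_le_iff_le_rpow (by norm_num) (by exact_mod_cast hr)]
      exact Nat.floor_le (by positivity)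
    have i1 := c.f1 (fun _ => s.1) (fun _ => s.2)
    have i2 := c.f2 (fun _ => s.2) i1
    have h3' := le_of_mul_le_mul_left (h3.trans (hrate _ i2.pos)) hn'
    have h4' := le_of_mul_le_mul_left (h4.trans (hrate _ i1.pos)) hn'
    rw [Prod.dist_eq, max_lt_iff, Real.dist_eq, Real.dist_eq, abs_lt, abs_lt] at hdist
    refine ⟨W, fun s _ => hW s, fun j => ?_⟩
    fin_cases j
    · exact h1
    · exact h2
    · exact h3'.trans (show R'.2 ≤ R.2 + ε by linarith [hdist.2.1])
    · exact h4'.trans (show R'.1 ≤ R.1 + ε by linarith [hdist.1.1])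

end CodeConverse

/-! ### Random codebooks -/

section Codebook

open Classical in
/-- Covering with an i.i.d. codebook: if each source value `u` of positive weight is matched by a
random codeword with probability at least `a`, the expected weight of the source values matched by
none of `L` codewords is at most a fraction `exp (-L a)`. -/
theorem sum_codebook_uncovered_le {U A : Type*} [Fintype U] [Fintype A] {Q : A → ℝ}
    (hQ : ∀ v, 0 ≤ Q v) (hQ1 : ∑ v, Q v = 1) {w : U → ℝ} (hw : ∀ u, 0 ≤ w u) (T : U → A → Prop)
    {a : ℝ} (hT : ∀ u, 0 < w u → a ≤ ∑ v, if T u v then Q v else 0) (L : ℕ) :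
    ∑ c : Fin L → A, (∏ l, Q (c l)) * ∑ u, (if ∀ l, ¬ T u (c l) then w u else 0) ≤
      (∑ u, w u) * Real.exp (-(L * a)) := by
  simp only [Finset.mul_sum]
  rw [Finset.sum_comm, Finset.sum_mul]
  refine Finset.sum_le_sum fun u _ => ?_
  rcases (hw u).eq_or_lt with h0 | h0
  · simp [← h0]
  have h1 : ∀ c : Fin L → A, (∏ l, Q (c l)) * (if ∀ l, ¬ T u (c l) then w u else 0) =
      w u * ∏ l, (if T u (c l) then 0 else Q (c l)) := by
    intro c
    split_ifs with h
    · rw [mul_comm]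
      congr 1
      exact Finset.prod_congr rfl fun l _ => by rw [if_neg (h l)]
    · obtain ⟨l, hl⟩ : ∃ l, T u (c l) := by simpa using h
      have hz : ∏ l, (if T u (c l) then 0 else Q (c l)) = 0 :=
        Finset.prod_eq_zero (Finset.mem_univ l) (if_pos hl)
      rw [hz, mul_zero, mul_zero]
  simp only [h1]
  rw [← Finset.mul_sum, sum_prod_pi (fun _ v => if T u v then 0 else Q v)]
  simp only [Finset.prod_const, Finset.card_univ, Fintype.card_fin]
  have h2 : ∑ v, (if T u v then 0 else Q v) = 1 - ∑ v, if T u v then Q v else 0 := by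
    rw [← hQ1, ← Finset.sum_sub_distrib]
    exact Finset.sum_congr rfl fun v _ => by split_ifs <;> simp
  have h3 : 0 ≤ ∑ v, (if T u v then 0 else Q v) :=
    Finset.sum_nonneg fun v _ => by split_ifs <;> simp [hQ]
  have h4 : ∑ v, (if T u v then 0 else Q v) ≤ Real.exp (-a) := by
    have := Real.add_one_le_exp (-a)
    have := hT u h0
    linarith
  refine mul_le_mul_of_nonneg_left ((pow_le_pow_left₀ h3 h4 L).trans (le_of_eq ?_)) h0.le
  rw [← Real.exp_nat_mul]
  ring_nf

/-- Some value of a function is at most its mean. -/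
theorem exists_le_of_sum_mul_le {C : Type*} [Fintype C] {w F : C → ℝ} (hw : ∀ c, 0 ≤ w c)
    (hw1 : ∑ c, w c = 1) {η : ℝ} (h : ∑ c, w c * F c ≤ η) : ∃ c, F c ≤ η := by
  by_contra! hF
  have h1 : ∑ c, w c * (F c - η) ≤ 0 := by
    simp only [mul_sub, Finset.sum_sub_distrib]
    rw [← Finset.sum_mul, hw1]; linarith
  have h2 : ∀ c, 0 ≤ w c * (F c - η) := fun c => mul_nonneg (hw c) (sub_pos.2 (hF c)).le
  have h3 := (Finset.sum_eq_zero_iff_of_nonneg fun c _ => h2 c).1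
    (le_antisymm h1 (Finset.sum_nonneg fun c _ => h2 c))
  have h4 : ∀ c, w c = 0 := fun c =>
    (mul_eq_zero.1 (h3 c (Finset.mem_univ c))).resolve_right (sub_pos.2 (hF c)).ne'
  simp [h4] at hw1

open Classical in
/-- Markov's inequality for conditional probabilities: either the set `T` carries at least half of
the mass, or the total mass is at most twice the mass outside `T`. -/
theorem ite_half_le {V : Type*} [Fintype V] {p : V → ℝ} (hp : ∀ v, 0 ≤ p v) (T : V → Prop)
    {s : ℝ} (hs : ∑ v, p v = s) {G : Prop}
    (hG : G ↔ 0 < s ∧ s / 2 ≤ ∑ v, if T v then p v else 0) :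
    (if G then 0 else s) ≤
      2 * ∑ v, if T v then 0 else p v := by
  have h1 : ∑ v, (if T v then p v else 0) + ∑ v, (if T v then 0 else p v) = s := by
    rw [← hs, ← Finset.sum_add_distrib]
    exact Finset.sum_congr rfl fun v _ => by split_ifs <;> simp
  have h2 : 0 ≤ ∑ v, (if T v then 0 else p v) :=
    Finset.sum_nonneg fun v _ => by split_ifs <;> simp [hp]
  split_ifs with h
  · linarith
  · by_cases h0 : 0 < s
    · have := not_le.1 fun h' => h (hG.2 ⟨h0, h'⟩)
      linarith
    · linarith

/-- The elements of a set of at most `K` elements can be indexed by `Fin K`. -/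
theorem exists_index {M K : ℕ} (hM : 0 < M) (hK : 0 < K) (s : Finset (Fin M)) :
    ∃ (enc : Fin M → Fin K) (dec : Fin K → Fin M), s.card ≤ K → ∀ m ∈ s, dec (enc m) = m := by
  classical
  by_cases hs : s.card ≤ K
  · let enc : Fin M → Fin K := fun m =>
      if hm : m ∈ s then Fin.castLE hs (s.equivFin ⟨m, hm⟩) else ⟨0, hK⟩
    have : Nonempty (Fin M) := ⟨⟨0, hM⟩⟩
    have hinj : Set.InjOn enc (s : Set (Fin M)) := by
      intro m hm m' hm' h
      simp only [enc, dif_pos (Finset.mem_coe.1 hm), dif_pos (Finset.mem_coe.1 hm')] at h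
      simpa using h
    exact ⟨enc, Function.invFunOn enc s, fun _ m hm => hinj.leftInvOn_invFunOn hm⟩
  · exact ⟨fun _ => ⟨0, hK⟩, fun _ => ⟨0, hM⟩, fun h => absurd h hs⟩

end Codebook

/-! ### Achievability for a single use of the source -/

section OneShot

open Classical in
/-- One-shot achievability. The letters `x`, `y`, `a`, `b` stand for the source, the side
information and the reconstructions at User 1 and User 2; `q` is a joint probability mass function,
the other functions are its marginals. On the set `T` of desired quadruples the information
densities of `(x, y)` and `b` and of `x` and `a` given `(y, b)` are at most `log α` and `log β`, and
that of `y` and `b` is at least `log l`. The codebook for User 2 has `M` words. Given `y`, only about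
`M / l` of them are plausible, and the message to User 1 is the index of the word in the list of
these (of length at most `K`), together with the index of `a` in a codebook of `L` words which
depends on `y` and on the word for User 2. -/
theorem exists_oneShot_code {𝒳 𝒴 𝒜 ℬ : Type*} [Fintype 𝒳] [Fintype 𝒴] [Fintype 𝒜] [Fintype ℬ]
    [Nonempty 𝒜] {q : 𝒳 → 𝒴 → 𝒜 → ℬ → ℝ} {qxyb : 𝒳 → 𝒴 → ℬ → ℝ} {qyab : 𝒴 → 𝒜 → ℬ → ℝ}
    {qxy : 𝒳 → 𝒴 → ℝ} {qyb : 𝒴 → ℬ → ℝ} {qy : 𝒴 → ℝ} {qb : ℬ → ℝ}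
    (hq : ∀ x y a b, 0 ≤ q x y a b)
    (hxyb : ∀ x y b, ∑ a, q x y a b = qxyb x y b) (hyab : ∀ y a b, ∑ x, q x y a b = qyab y a b)
    (hxy : ∀ x y, ∑ b, qxyb x y b = qxy x y) (hyb : ∀ y b, ∑ x, qxyb x y b = qyb y b)
    (hy : ∀ y, ∑ b, qyb y b = qy y) (hb : ∀ b, ∑ y, qyb y b = qb b) (hb1 : ∑ b, qb b = 1)
    {T : 𝒳 → 𝒴 → 𝒜 → ℬ → Prop} {α β l : ℝ} (hα : 0 < α) (hβ : 0 < β) (hl : 0 < l)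
    (hTα : ∀ x y a b, T x y a b → qxyb x y b ≤ α * (qxy x y * qb b))
    (hTl : ∀ x y a b, T x y a b → l * (qy y * qb b) ≤ qyb y b)
    (hTβ : ∀ x y a b, T x y a b → q x y a b * qyb y b ≤ β * (qxyb x y b * qyab y a b))
    {M K L : ℕ} (hM : 0 < M) (hK : 0 < K) (hL : 0 < L) :
    ∃ (f1 : 𝒳 → 𝒴 → Fin K × Fin L) (f2 : 𝒴 → Fin K × Fin L → Fin M)
      (g1 : 𝒴 → Fin K × Fin L → 𝒜) (g2 : Fin M → ℬ),
      ∑ x, ∑ y, (if T x y (g1 y (f1 x y)) (g2 (f2 y (f1 x y))) then 0 else qxy x y) ≤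
        4 * (∑ x, ∑ y, ∑ b, ∑ a, if T x y a b then 0 else q x y a b) +
          Real.exp (-(M * (1 / (2 * α)))) + Real.exp (-(L * (1 / (2 * β)))) + M / l / K := by
  have hxyb0 : ∀ x y b, 0 ≤ qxyb x y b := fun x y b => by
    rw [← hxyb]; exact Finset.sum_nonneg fun _ _ => hq _ _ _ _
  have hyab0 : ∀ y a b, 0 ≤ qyab y a b := fun y a b => by
    rw [← hyab]; exact Finset.sum_nonneg fun _ _ => hq _ _ _ _
  have hxy0 : ∀ x y, 0 ≤ qxy x y := fun x y => by
    rw [← hxy]; exact Finset.sum_nonneg fun _ _ => hxyb0 _ _ _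
  have hyb0 : ∀ y b, 0 ≤ qyb y b := fun y b => by
    rw [← hyb]; exact Finset.sum_nonneg fun _ _ => hxyb0 _ _ _
  have hy0 : ∀ y, 0 ≤ qy y := fun y => by
    rw [← hy]; exact Finset.sum_nonneg fun _ _ => hyb0 _ _
  have hb0 : ∀ b, 0 ≤ qb b := fun b => by
    rw [← hb]; exact Finset.sum_nonneg fun _ _ => hyb0 _ _
  have hyb' : ∀ y b, ∑ a, qyab y a b = qyb y b := fun y b => by
    simp only [← hyab, ← hyb, ← hxyb]; exact Finset.sum_comm
  have hyx : ∀ y, ∑ x, qxy x y = qy y := fun y => by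
    simp only [← hxy, ← hy, ← hyb]; exact Finset.sum_comm
  have hy1 : ∑ y, qy y = 1 := by
    simp only [← hy, ← hb1, ← hb]; exact Finset.sum_comm
  have hK' : (0 : ℝ) < K := by exact_mod_cast hK
  -- pairs `(x, y)`, triples `(x, y, b)` for which a random continuation is likely to be in `T`
  obtain ⟨T1, hT1_iff⟩ : ∃ T1 : 𝒳 → 𝒴 → ℬ → Prop, ∀ x y b, T1 x y b ↔
      0 < qxyb x y b ∧ qxyb x y b / 2 ≤ ∑ a, if T x y a b then q x y a b else 0 :=
    ⟨_, fun _ _ _ => Iff.rfl⟩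
  obtain ⟨G, hG_iff⟩ : ∃ G : 𝒳 → 𝒴 → Prop, ∀ x y, G x y ↔
      0 < qxy x y ∧ qxy x y / 2 ≤ ∑ b, if T1 x y b then qxyb x y b else 0 :=
    ⟨_, fun _ _ => Iff.rfl⟩
  have hT1 : ∀ x y b, T1 x y b → ∃ a, T x y a b := by
    intro x y b hxyb1
    obtain ⟨h0, h1⟩ := (hT1_iff x y b).1 hxyb1
    by_contra! h
    simp only [h, if_false, Finset.sum_const_zero] at h1
    linarith
  have hG : ∑ x, ∑ y, (if G x y then 0 else qxy x y) ≤
      4 * ∑ x, ∑ y, ∑ b, ∑ a, if T x y a b then 0 else q x y a b := by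
    simp only [Finset.mul_sum]
    refine Finset.sum_le_sum fun x _ => Finset.sum_le_sum fun y _ => ?_
    refine (ite_half_le (hxyb0 x y) (T1 x y) (hxy x y) (hG_iff x y)).trans ?_
    rw [Finset.mul_sum]
    refine Finset.sum_le_sum fun b _ => ?_
    have := ite_half_le (fun a => hq x y a b) (fun a => T x y a b) (hxyb x y b) (hT1_iff x y b)
    rw [← Finset.mul_sum]
    linarith
  -- a word `b` is on the list of `y` when the information density of `(y, b)` is at least `log l`;
  -- a single codebook has to cover the pairs in `G` and keep the mean length of the lists small
  obtain ⟨S, hS_iff⟩ : ∃ S : 𝒴 → ℬ → Prop, ∀ y b, S y b ↔ l * (qy y * qb b) ≤ qyb y b :=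
    ⟨_, fun _ _ => Iff.rfl⟩
  let w : 𝒳 × 𝒴 → ℝ := fun s => if G s.1 s.2 then qxy s.1 s.2 else 0
  have hw0 : ∀ s, 0 ≤ w s := fun s => by dsimp only [w]; split_ifs <;> simp [hxy0]
  have hw1 : ∑ s, w s ≤ 1 := by
    calc ∑ s, w s ≤ ∑ s : 𝒳 × 𝒴, qxy s.1 s.2 :=
          Finset.sum_le_sum fun s _ => by dsimp only [w]; split_ifs <;> simp [hxy0]
      _ = 1 := by rw [Fintype.sum_prod_type, Finset.sum_comm]; simp only [hyx, hy1]
  have hcover := sum_codebook_uncovered_le hb0 hb1 hw0 (fun s b => T1 s.1 s.2 b)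
    (a := 1 / (2 * α)) (by
      rintro ⟨x, y⟩ hs
      have hg : G x y := by
        by_contra h
        simp [w, h] at hs
      have h1 : ∑ b, (if T1 x y b then qxyb x y b else 0) ≤
          ∑ b, α * qxy x y * (if T1 x y b then qb b else 0) := by
        refine Finset.sum_le_sum fun b _ => ?_
        split_ifs with h
        · obtain ⟨a, ha⟩ := hT1 x y b h
          exact (hTα x y a b ha).trans (le_of_eq (by ring))
        · simp
      rw [← Finset.mul_sum] at h1
      have h2 := ((hG_iff x y).1 hg).2.trans h1
      have h3 : qxy x y * 1 ≤ qxy x y * (2 * α * ∑ b, (if T1 x y b then qb b else 0)) := by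
        linarith
      have h4 := le_of_mul_le_mul_left h3 ((hG_iff x y).1 hg).1
      change 1 / (2 * α) ≤ ∑ b, if T1 x y b then qb b else 0
      rw [div_le_iff₀ (by positivity)]
      linarith) M
  have hlist : ∑ c : Fin M → ℬ, (∏ m, qb (c m)) * ∑ m, ∑ y, (if S y (c m) then qy y else 0) ≤
      M / l := by
    have h1 : ∀ m : Fin M, ∑ c : Fin M → ℬ, (∏ m, qb (c m)) *
        ∑ y, (if S y (c m) then qy y else 0) ≤ 1 / l := by
      intro m
      rw [sum_prod_mul_coord hb1 m fun b => ∑ y, if S y b then qy y else 0]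
      calc _ ≤ ∑ b, ∑ y, qyb y b / l := by
            refine Finset.sum_le_sum fun b _ => ?_
            rw [Finset.mul_sum]
            refine Finset.sum_le_sum fun y _ => ?_
            split_ifs with h
            · rw [le_div_iff₀ hl]
              exact le_trans (le_of_eq (by ring)) ((hS_iff y b).1 h)
            · rw [mul_zero]; exact div_nonneg (hyb0 _ _) hl.le
        _ = 1 / l := by simp only [← Finset.sum_div, hb, hb1]
    simp only [Finset.mul_sum (s := (Finset.univ : Finset (Fin M)))]
    rw [Finset.sum_comm]
    refine (Finset.sum_le_sum fun m _ => h1 m).trans (le_of_eq ?_)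
    simp [div_eq_mul_inv]
  obtain ⟨c, hc⟩ : ∃ c : Fin M → ℬ,
      ∑ s, (if ∀ m, ¬ T1 s.1 s.2 (c m) then w s else 0) +
        (∑ m, ∑ y, if S y (c m) then qy y else 0) / K ≤
      Real.exp (-(M * (1 / (2 * α)))) + M / l / K := by
    refine exists_le_of_sum_mul_le (w := fun c : Fin M → ℬ => ∏ m, qb (c m))
      (fun c => Finset.prod_nonneg fun _ _ => hb0 _) (sum_prod_eq_one hb1) ?_
    simp only [mul_add, Finset.sum_add_distrib, ← mul_div_assoc, ← Finset.sum_div]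
    refine add_le_add (hcover.trans ?_) (div_le_div_of_nonneg_right hlist hK'.le)
    rw [mul_div_assoc]
    exact mul_le_of_le_one_left (Real.exp_nonneg _) hw1
  -- a word for User 2 from which `T` is likely to be reached, if there is one
  have hsel : ∀ x y, ∃ m, (∃ m', T1 x y (c m')) → T1 x y (c m) := fun x y => by
    by_cases h : ∃ m', T1 x y (c m')
    · obtain ⟨m, hm⟩ := h
      exact ⟨m, fun _ => hm⟩
    · exact ⟨⟨0, hM⟩, fun h' => absurd h' h⟩
  choose sel hsel using hsel
  -- for each `y` and each word, a codebook covering the `x` for which this word is chosen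
  let w2 : 𝒴 → Fin M → 𝒳 → ℝ := fun y m x =>
    if T1 x y (c m) ∧ sel x y = m then qxy x y else 0
  have hw20 : ∀ y m x, 0 ≤ w2 y m x := fun y m x => by dsimp only [w2]; split_ifs <;> simp [hxy0]
  have hbook : ∀ y m, ∃ k : Fin L → 𝒜,
      ∑ x, (if ∀ i, ¬ T x y (k i) (c m) then w2 y m x else 0) ≤
        (∑ x, w2 y m x) * Real.exp (-(L * (1 / (2 * β)))) := by
    intro y m
    by_cases hx : ∃ x, T1 x y (c m)
    · obtain ⟨x₀, hx₀⟩ := hx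
      have hpos : 0 < qyb y (c m) := by
        rw [← hyb]
        exact ((hT1_iff _ _ _).1 hx₀).1.trans_le (Finset.single_le_sum (f := fun x => qxyb x y (c m))
          (fun x _ => hxyb0 _ _ _) (Finset.mem_univ x₀))
      have hQ0 : ∀ a, 0 ≤ qyab y a (c m) / qyb y (c m) := fun a => div_nonneg (hyab0 _ _ _) hpos.le
      have hQ1 : ∑ a, qyab y a (c m) / qyb y (c m) = 1 := by
        rw [← Finset.sum_div, hyb', div_self hpos.ne']
      refine exists_le_of_sum_mul_le
        (w := fun k : Fin L → 𝒜 => ∏ i, qyab y (k i) (c m) / qyb y (c m))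
        (fun k => Finset.prod_nonneg fun _ _ => hQ0 _) (sum_prod_eq_one hQ1) ?_
      refine sum_codebook_uncovered_le hQ0 hQ1 (hw20 y m) (fun x a => T x y a (c m)) ?_ L
      intro x hx
      have ht : T1 x y (c m) := by
        by_contra h
        simp [w2, h] at hx
      have h1 : ∑ a, (if T x y a (c m) then q x y a (c m) else 0) ≤
          ∑ a, β * qxyb x y (c m) *
            (if T x y a (c m) then qyab y a (c m) / qyb y (c m) else 0) := by
        refine Finset.sum_le_sum fun a _ => ?_
        split_ifs with h
        · rw [← mul_div_assoc, le_div_iff₀ hpos]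
          exact (hTβ x y a (c m) h).trans (le_of_eq (by ring))
        · simp
      rw [← Finset.mul_sum] at h1
      have h2 := ((hT1_iff _ _ _).1 ht).2.trans h1
      have h3 : qxyb x y (c m) * 1 ≤ qxyb x y (c m) * (2 * β * ∑ a,
          (if T x y a (c m) then qyab y a (c m) / qyb y (c m) else 0)) := by
        linarith
      have h4 := le_of_mul_le_mul_left h3 ((hT1_iff _ _ _).1 ht).1
      rw [div_le_iff₀ (by positivity)]
      linarith
    · push Not at hx
      refine ⟨fun _ => Classical.arbitrary 𝒜, ?_⟩
      simp [w2, hx]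
  choose k hk using hbook
  have hidx : ∀ x y, ∃ i, (∃ i', T x y (k y (sel x y) i') (c (sel x y))) →
      T x y (k y (sel x y) i) (c (sel x y)) := fun x y => by
    by_cases h : ∃ i', T x y (k y (sel x y) i') (c (sel x y))
    · obtain ⟨i, hi⟩ := h
      exact ⟨i, fun _ => hi⟩
    · exact ⟨⟨0, hL⟩, fun h' => absurd h' h⟩
  choose idx hidx using hidx
  let lst : 𝒴 → Finset (Fin M) := fun y => Finset.univ.filter fun m => S y (c m)
  choose enc dec hdec using fun y => exists_index hM hK (lst y)
  refine ⟨fun x y => (enc y (sel x y), idx x y), fun y t => dec y t.1,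
    fun y t => k y (dec y t.1) t.2, c, ?_⟩
  dsimp only
  have hstage1 : ∑ x, ∑ y, (if ∀ m, ¬ T1 x y (c m) then w (x, y) else 0) =
      ∑ s, (if ∀ m, ¬ T1 s.1 s.2 (c m) then w s else 0) := by
    rw [Fintype.sum_prod_type]
  have hstage2 : ∑ x, ∑ y, (if T1 x y (c (sel x y)) ∧
      ∀ i, ¬ T x y (k y (sel x y) i) (c (sel x y)) then qxy x y else 0) ≤
      Real.exp (-(L * (1 / (2 * β)))) := by
    calc _ = ∑ y, ∑ m, ∑ x, (if ∀ i, ¬ T x y (k y m i) (c m) then w2 y m x else 0) := by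
          rw [Finset.sum_comm]
          refine Finset.sum_congr rfl fun y _ => ?_
          rw [Finset.sum_comm]
          refine Finset.sum_congr rfl fun x _ => ?_
          rw [Finset.sum_eq_single (sel x y)]
          · simp only [w2, and_true]
            rw [← ite_and]
            simp only [and_comm]
          · intro m _ hm
            simp [w2, hm.symm]
          · simp
      _ ≤ ∑ y, ∑ m, (∑ x, w2 y m x) * Real.exp (-(L * (1 / (2 * β)))) :=
          Finset.sum_le_sum fun y _ => Finset.sum_le_sum fun m _ => hk y m
      _ = (∑ y, ∑ m, ∑ x, w2 y m x) * Real.exp (-(L * (1 / (2 * β)))) := by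
          simp only [← Finset.sum_mul]
      _ ≤ 1 * Real.exp (-(L * (1 / (2 * β)))) := by
          refine mul_le_mul_of_nonneg_right ?_ (Real.exp_nonneg _)
          rw [← hy1]
          refine Finset.sum_le_sum fun y _ => ?_
          rw [← hyx, Finset.sum_comm]
          refine Finset.sum_le_sum fun x _ => ?_
          rw [Finset.sum_eq_single (sel x y)]
          · dsimp only [w2]; split_ifs <;> simp [hxy0]
          · intro m _ hm
            simp [w2, hm.symm]
          · simp
      _ = _ := one_mul _
  have hstage3 : ∑ x, ∑ y, (if K < (lst y).card then qxy x y else 0) ≤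
      (∑ m, ∑ y, if S y (c m) then qy y else 0) / K := by
    rw [Finset.sum_comm, Finset.sum_comm (s := (Finset.univ : Finset (Fin M))), Finset.sum_div]
    refine Finset.sum_le_sum fun y _ => ?_
    have h1 : ∑ m, (if S y (c m) then qy y else 0) = (lst y).card * qy y := by
      rw [← Finset.sum_filter, Finset.sum_const, nsmul_eq_mul]
    rw [h1, le_div_iff₀ hK']
    split_ifs with h
    · rw [hyx, mul_comm]
      exact mul_le_mul_of_nonneg_right (by exact_mod_cast h.le) (hy0 y)
    · simp only [Finset.sum_const_zero, zero_mul]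
      exact mul_nonneg (by positivity) (hy0 y)
  have hpt : ∀ x y, (if T x y (k y (dec y (enc y (sel x y))) (idx x y))
      (c (dec y (enc y (sel x y)))) then 0 else qxy x y) ≤
      (if G x y then 0 else qxy x y) + (if ∀ m, ¬ T1 x y (c m) then w (x, y) else 0) +
      (if T1 x y (c (sel x y)) ∧
        ∀ i, ¬ T x y (k y (sel x y) i) (c (sel x y)) then qxy x y else 0) +
      (if K < (lst y).card then qxy x y else 0) := by
    intro x y
    have n1 : 0 ≤ (if G x y then 0 else qxy x y) := by split_ifs <;> simp [hxy0]
    have n2 : 0 ≤ (if ∀ m, ¬ T1 x y (c m) then w (x, y) else 0) := by split_ifs <;> simp [hw0]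
    have n3 : 0 ≤ (if T1 x y (c (sel x y)) ∧
        ∀ i, ¬ T x y (k y (sel x y) i) (c (sel x y)) then qxy x y else 0) := by
      split_ifs <;> simp [hxy0]
    have n4 : 0 ≤ (if K < (lst y).card then qxy x y else 0) := by split_ifs <;> simp [hxy0]
    by_cases hT : T x y (k y (dec y (enc y (sel x y))) (idx x y)) (c (dec y (enc y (sel x y))))
    · rw [if_pos hT]; linarith
    rw [if_neg hT]
    by_cases g1 : G x y
    swap
    · rw [if_neg g1] at n1 ⊢; linarith
    by_cases g2 : ∀ m, ¬ T1 x y (c m)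
    · have : w (x, y) = qxy x y := if_pos g1
      rw [if_pos g2, this] at n2 ⊢; linarith
    by_cases g4 : K < (lst y).card
    · rw [if_pos g4] at n4 ⊢; linarith
    push Not at g2
    have g5 := hsel x y g2
    have g6 : sel x y ∈ lst y := by
      obtain ⟨a, ha⟩ := hT1 _ _ _ g5
      exact Finset.mem_filter.2 ⟨Finset.mem_univ _, (hS_iff _ _).2 (hTl _ _ _ _ ha)⟩
    rw [hdec y (not_lt.1 g4) _ g6] at hT
    have g3 : T1 x y (c (sel x y)) ∧ ∀ i, ¬ T x y (k y (sel x y) i) (c (sel x y)) :=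
      ⟨g5, fun i hi => hT (hidx x y ⟨i, hi⟩)⟩
    rw [if_pos g3] at n3 ⊢; linarith
  refine (Finset.sum_le_sum fun x _ => Finset.sum_le_sum fun y _ => hpt x y).trans ?_
  simp only [Finset.sum_add_distrib]
  rw [hstage1]
  linarith

end OneShot

/-! ### Weak law of large numbers -/

section WLLN

variable {S : Type*} [Fintype S]

/-- Variances of independent variables add up. -/
theorem sum_prod_mul_sq {P : S → ℝ} (hP1 : ∑ s, P s = 1) {g : S → ℝ} (hg : ∑ s, P s * g s = 0)
    (n : ℕ) : ∑ σ : Fin n → S, (∏ i, P (σ i)) * (∑ i, g (σ i)) ^ 2 = n * ∑ s, P s * g s ^ 2 := by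
  classical
  have hpair : ∀ i j : Fin n, ∑ σ : Fin n → S, (∏ k, P (σ k)) * (g (σ i) * g (σ j)) =
      if i = j then ∑ s, P s * g s ^ 2 else 0 := by
    intro i j
    split_ifs with h
    · subst h
      rw [← sum_prod_mul_coord hP1 i fun s => g s ^ 2]
      simp only [sq]
    · calc _ = ∑ σ : Fin n → S, ∏ k, (P (σ k) * (if k = i then g (σ k) else 1) *
            (if k = j then g (σ k) else 1)) := by
            refine Finset.sum_congr rfl fun σ _ => ?_
            simp only [Finset.prod_mul_distrib, Finset.prod_ite_eq', Finset.mem_univ, if_true,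
              mul_assoc]
        _ = 0 := by
            rw [sum_prod_pi (fun k s => P s * (if k = i then g s else 1) *
              (if k = j then g s else 1))]
            refine Finset.prod_eq_zero (Finset.mem_univ i) ?_
            simp [h, hg]
  simp only [sq (∑ i, _), Finset.sum_mul_sum]
  simp only [Finset.mul_sum]
  rw [Finset.sum_comm]
  have : ∀ i : Fin n, ∑ σ : Fin n → S, ∑ j, (∏ k, P (σ k)) * (g (σ i) * g (σ j)) =
      ∑ s, P s * g s ^ 2 := by
    intro i
    rw [Finset.sum_comm]
    simp [hpair]
  rw [Finset.sum_congr rfl fun i _ => this i]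
  simp [Finset.mul_sum]

open Classical in
/-- Weak law of large numbers for a finite family of functions. -/
theorem exists_forall_sum_prod_deviation_le {J : Type*} [Fintype J] {P : S → ℝ}
    (hP : ∀ s, 0 ≤ P s) (hP1 : ∑ s, P s = 1) (f : J → S → ℝ) {δ η : ℝ} (hδ : 0 < δ) (hη : 0 < η) :
    ∃ N : ℕ, ∀ n, N ≤ n → ∑ σ : Fin n → S,
      (if ∀ j, |∑ i, f j (σ i) - n * ∑ s, P s * f j s| < n * δ then 0 else ∏ i, P (σ i)) ≤ η := by
  set μ : J → ℝ := fun j => ∑ s, P s * f j s with hμ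
  set v : ℝ := ∑ j, ∑ s, P s * (f j s - μ j) ^ 2 with hv
  obtain ⟨N, hN⟩ := exists_nat_ge (v / (η * δ ^ 2))
  refine ⟨max N 1, fun n hn => ?_⟩
  have hn0 : (0 : ℝ) < n := by exact_mod_cast lt_of_lt_of_le one_pos ((le_max_right N 1).trans hn)
  have hnN : v / (η * δ ^ 2) ≤ n := hN.trans (by exact_mod_cast (le_max_left N 1).trans hn)
  have hPn : ∀ σ : Fin n → S, 0 ≤ ∏ i, P (σ i) := fun σ => Finset.prod_nonneg fun i _ => hP _
  have hcenter : ∀ j, ∑ s, P s * (f j s - μ j) = 0 := fun j => by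
    simp only [mul_sub, Finset.sum_sub_distrib]
    rw [← Finset.sum_mul, hP1, one_mul]
    exact sub_self _
  have hdev : ∀ j (σ : Fin n → S), ∑ i, f j (σ i) - n * μ j = ∑ i, (f j (σ i) - μ j) := by
    intro j σ; simp
  calc _ ≤ ∑ σ : Fin n → S, ∑ j,
        (∏ i, P (σ i)) * (∑ i, (f j (σ i) - μ j)) ^ 2 / (n * δ) ^ 2 := by
        refine Finset.sum_le_sum fun σ _ => ?_
        have hnn : ∀ j, 0 ≤ (∏ i, P (σ i)) * (∑ i, (f j (σ i) - μ j)) ^ 2 / (n * δ) ^ 2 := fun j =>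
          div_nonneg (mul_nonneg (hPn σ) (sq_nonneg _)) (sq_nonneg _)
        split_ifs with h
        · exact Finset.sum_nonneg fun j _ => hnn j
        · obtain ⟨j, hj⟩ := not_forall.1 h
          refine le_trans ?_ (Finset.single_le_sum (fun j _ => hnn j) (Finset.mem_univ j))
          rw [not_lt, hdev] at hj
          rw [le_div_iff₀ (by positivity)]
          refine mul_le_mul_of_nonneg_left ?_ (hPn σ)
          rw [← sq_abs (∑ i, _)]
          exact pow_le_pow_left₀ (by positivity) hj 2
    _ = n * v / (n * δ) ^ 2 := by
        rw [Finset.sum_comm, hv, Finset.mul_sum, Finset.sum_div]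
        refine Finset.sum_congr rfl fun j _ => ?_
        rw [← Finset.sum_div, sum_prod_mul_sq hP1 (g := fun s => f j s - μ j) (hcenter j)]
    _ ≤ η := by
        rw [div_le_iff₀ (by positivity)] at hnN
        rw [div_le_iff₀ (by positivity)]
        nlinarith

end WLLN

/-! ### Achievability -/

section Achievability

/-- Summing the law of a tuple over one of its components. -/
theorem sum_law_fiber {Ω α β γ : Type*} [Fintype Ω] [Fintype γ] (p : Ω → ℝ)
    {U : Ω → α} {V : Ω → β} {e : Ω → γ} {u : γ → α} {v : β}
    (h : ∀ ω c, U ω = u c ↔ V ω = v ∧ e ω = c) : ∑ c, law p U (u c) = law p V v := by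
  classical
  simp only [law, h]
  rw [Finset.sum_comm]
  refine Finset.sum_congr rfl fun ω _ => ?_
  rw [Finset.sum_eq_single (e ω)] <;> simp +contextual [eq_comm]

theorem prod_eq_rpow_sum_logb {n : ℕ} {z : Fin n → ℝ} (hz : ∀ i, 0 < z i) :
    ∏ i, z i = (2 : ℝ) ^ ∑ i, Real.logb 2 (z i) := by
  rw [Real.rpow_sum_of_pos (by norm_num)]
  exact Finset.prod_congr rfl fun i _ =>
    (Real.rpow_logb (by norm_num) (by norm_num) (hz i)).symm

/-- Encoders and decoders with message sets `Fin K × Fin L` and `Fin M` form a code for larger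
message sets. -/
theorem exists_code_of_le {X Y Xh1 Xh2 : Type*} {n K L M M1 M2 : ℕ} (h1 : K * L ≤ M1) (h2 : M ≤ M2)
    (hK : 0 < K) (hL : 0 < L) (hM : 0 < M)
    (f1 : (Fin n → X) → (Fin n → Y) → Fin K × Fin L) (f2 : (Fin n → Y) → Fin K × Fin L → Fin M)
    (g1 : (Fin n → Y) → Fin K × Fin L → (Fin n → Xh1)) (g2 : Fin M → (Fin n → Xh2)) :
    ∃ c : Code X Y Xh1 Xh2 n M1 M2, (∀ x y, c.recon1 x y = g1 y (f1 x y)) ∧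
      ∀ x y, c.recon2 x y = g2 (f2 y (f1 x y)) := by
  have : Nonempty (Fin K × Fin L) := ⟨(⟨0, hK⟩, ⟨0, hL⟩)⟩
  have : Nonempty (Fin M) := ⟨⟨0, hM⟩⟩
  obtain ⟨e⟩ : Nonempty ((Fin K × Fin L) ↪ Fin M1) :=
    Function.Embedding.nonempty_of_card_le (by simpa using h1)
  have he : ∀ t, Function.invFun e (e t) = t := Function.leftInverse_invFun e.injective
  have hc : ∀ t, Function.invFun (Fin.castLE h2) (Fin.castLE h2 t) = t :=
    Function.leftInverse_invFun (Fin.castLE_injective h2)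
  exact ⟨⟨fun x y => e (f1 x y), fun y t => Fin.castLE h2 (f2 y (Function.invFun e t)),
    fun y t => g1 y (Function.invFun e t), fun m => g2 (Function.invFun (Fin.castLE h2) m)⟩,
    fun x y => by simp only [Code.recon1, he], fun x y => by simp only [Code.recon2, he, hc]⟩


variable {X Y Xh1 Xh2 : Type*} [Fintype X] [Fintype Y] [Fintype Xh1] [Fintype Xh2]

open Classical in
/-- A distortion that is at most `D` on a good event and bounded by `B` everywhere. -/
theorem expectIID_seqDist_le {Z : Type*} {P : X × Y → ℝ} (hP : P ∈ stdSimplex ℝ (X × Y))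
    {d : X → Z → ℝ} {n : ℕ} {r : (Fin n → X) → (Fin n → Y) → Fin n → Z}
    {good : (Fin n → X) → (Fin n → Y) → Prop} {B D e : ℝ} (hB : ∀ x z, d x z ≤ B) (hB0 : 0 ≤ B)
    (hD : 0 ≤ D) (hgood : ∀ x y, good x y → seqDist d x (r x y) ≤ D)
    (he : ∑ x : Fin n → X, ∑ y : Fin n → Y, (if good x y then 0 else ∏ i, P (x i, y i)) ≤ e) :
    expectIID P (fun x y => seqDist d x (r x y)) ≤ D + B * e := by
  have hPn : ∀ (x : Fin n → X) (y : Fin n → Y), 0 ≤ ∏ i, P (x i, y i) := fun x y =>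
    Finset.prod_nonneg fun i _ => hP.1 _
  have hseq : ∀ (x : Fin n → X) (z : Fin n → Z), seqDist d x z ≤ B := by
    intro x z
    rcases Nat.eq_zero_or_pos n with h | h
    · subst h; simpa [seqDist] using hB0
    · have hn : (0 : ℝ) < n := by exact_mod_cast h
      rw [seqDist, one_div, inv_mul_le_iff₀ hn]
      refine (Finset.sum_le_sum fun j _ => hB (x j) (z j)).trans (le_of_eq ?_)
      simp
  have h1 : ∑ x : Fin n → X, ∑ y : Fin n → Y, ∏ i, P (x i, y i) = 1 := by
    have h := expectIID_eq P (n := n) (fun _ _ => (1 : ℝ))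
    simp only [expectIID, mul_one] at h
    rw [h, sum_prod_eq_one hP.2]
  calc _ ≤ ∑ x : Fin n → X, ∑ y : Fin n → Y,
        ((∏ i, P (x i, y i)) * D + B * (if good x y then 0 else ∏ i, P (x i, y i))) := by
        refine Finset.sum_le_sum fun x _ => Finset.sum_le_sum fun y _ => ?_
        split_ifs with h
        · rw [mul_zero, add_zero]
          exact mul_le_mul_of_nonneg_left (hgood x y h) (hPn x y)
        · have := mul_le_mul_of_nonneg_left (hseq x (r x y)) (hPn x y)
          have := mul_nonneg (hPn x y) hD
          linarith
    _ = D + B * ∑ x : Fin n → X, ∑ y : Fin n → Y,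
          (if good x y then 0 else ∏ i, P (x i, y i)) := by
        simp only [Finset.sum_add_distrib, ← Finset.sum_mul, ← Finset.mul_sum, h1, one_mul]
    _ ≤ _ := by gcongr

/-- Sizes of the codebooks: with `u = 2 ^ (n δ)` and `v = 2 ^ (n I)` for the various informations
`I`, codebooks slightly larger than the information densities require keep the error terms of
`exists_oneShot_code` of order `1 / u`. -/
theorem exists_codebook_sizes {vY vC v3 u : ℝ} (hY : 0 < vY) (hC : 1 ≤ vC) (h3 : 1 ≤ v3)
    (h2 : 1 ≤ vY * vC) (hu : 4 ≤ u) :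
    ∃ M K L : ℕ, 0 < M ∧ 0 < K ∧ 0 < L ∧ (M : ℝ) ≤ vY * vC * u ^ 7 ∧
      ((K * L : ℕ) : ℝ) ≤ vC * v3 * u ^ 7 ∧
      Real.exp (-(M * (1 / (2 * (vY * vC * u))))) ≤ 2 / u ∧
      Real.exp (-(L * (1 / (2 * (v3 * u))))) ≤ 2 / u ∧ (M : ℝ) / (vY / u) / K ≤ 2 / u := by
  have hu0 : 0 < u := by linarith
  have hu1 : 1 ≤ u := by linarith
  have hceil : ∀ t : ℝ, 1 ≤ t → 0 < ⌈t⌉₊ ∧ t ≤ ⌈t⌉₊ ∧ (⌈t⌉₊ : ℝ) ≤ 2 * t := fun t ht =>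
    ⟨Nat.ceil_pos.2 (by linarith), Nat.le_ceil t, by
      have := Nat.ceil_lt_add_one (a := t) (by linarith); linarith⟩
  have hexp : ∀ v : ℝ, 0 < v → ∀ m : ℝ, v * u ^ 2 ≤ m →
      Real.exp (-(m * (1 / (2 * (v * u))))) ≤ 2 / u := by
    intro v hv m hm
    have h1 : u / 2 ≤ m * (1 / (2 * (v * u))) := by
      rw [mul_one_div, le_div_iff₀ (by positivity)]
      nlinarith
    have h2 : u / 2 ≤ Real.exp (m * (1 / (2 * (v * u)))) := by
      have := Real.add_one_le_exp (m * (1 / (2 * (v * u))))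
      linarith
    rw [Real.exp_neg]
    calc _ ≤ (u / 2)⁻¹ := inv_anti₀ (by positivity) h2
      _ = 2 / u := by rw [inv_div]
  obtain ⟨M0, M1, M2⟩ := hceil (vY * vC * u ^ 2) (one_le_mul_of_one_le_of_one_le h2
    (one_le_pow₀ hu1))
  obtain ⟨K0, K1, K2⟩ := hceil (vC * u ^ 4) (one_le_mul_of_one_le_of_one_le hC (one_le_pow₀ hu1))
  obtain ⟨L0, L1, L2⟩ := hceil (v3 * u ^ 2) (one_le_mul_of_one_le_of_one_le h3 (one_le_pow₀ hu1))
  refine ⟨_, _, _, M0, K0, L0, ?_, ?_, hexp _ (by linarith) _ M1, hexp _ (by linarith) _ L1, ?_⟩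
  · refine M2.trans ?_
    have : 2 * u ^ 2 ≤ u ^ 7 := by
      have : 2 ≤ u ^ 5 := by
        have := pow_le_pow_right₀ hu1 (show 1 ≤ 5 by norm_num)
        linarith
      nlinarith [pow_pos hu0 2]
    calc 2 * (vY * vC * u ^ 2) = vY * vC * (2 * u ^ 2) := by ring
      _ ≤ _ := mul_le_mul_of_nonneg_left this (by linarith)
  · push_cast
    calc _ ≤ (2 * (vC * u ^ 4)) * (2 * (v3 * u ^ 2)) := by gcongr
      _ = vC * v3 * u ^ 6 * 4 := by ring
      _ ≤ vC * v3 * u ^ 6 * u := by gcongr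
      _ = _ := by ring
  · have hK : 0 < vC * u ^ 4 := by positivity
    calc _ ≤ 2 * (vY * vC * u ^ 2) / (vY / u) / (vC * u ^ 4) := by gcongr
      _ = 2 / u := by field_simp


open Classical in
/-- The one-shot code applied to blocks, with the jointly typical quadruples of sequences as the
desired ones. The rates exceed the informations by `7 δ`, which leaves room for codebooks that are
larger than the information densities require by factors `2 ^ (n δ)`. -/
theorem exists_block_code {P : X × Y → ℝ} (hP : P ∈ stdSimplex ℝ (X × Y))
    {W : X × Y → Xh1 × Xh2 → ℝ} (hW : ∀ s, W s ∈ stdSimplex ℝ (Xh1 × Xh2))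
    (d1 : X → Xh1 → ℝ) (d2 : X → Xh2 → ℝ) {δ η : ℝ} (hδ : 0 < δ) (hη : 0 < η)
    {R : ℝ × ℝ}
    (hR1 : condMutualInfo (joint P W) (fun ω : X × Y × Xh1 × Xh2 => ω.1) (fun ω => ω.2.2)
      (fun ω => ω.2.1) + 7 * δ ≤ R.1)
    (hR2 : mutualInfo (joint P W) (fun ω : X × Y × Xh1 × Xh2 => (ω.1, ω.2.1))
      (fun ω => ω.2.2.2) + 7 * δ ≤ R.2) :
    ∃ N : ℕ, ∀ n, N ≤ n →
      ∃ (c : Code X Y Xh1 Xh2 n ⌊(2 : ℝ) ^ ((n : ℝ) * R.1)⌋₊ ⌊(2 : ℝ) ^ ((n : ℝ) * R.2)⌋₊)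
        (good : (Fin n → X) → (Fin n → Y) → Prop),
      (∀ x y, good x y →
        seqDist d1 x (c.recon1 x y) ≤ ∑ ω, joint P W ω * d1 ω.1 ω.2.2.1 + δ ∧
        seqDist d2 x (c.recon2 x y) ≤ ∑ ω, joint P W ω * d2 ω.1 ω.2.2.2 + δ) ∧
      ∑ x : Fin n → X, ∑ y : Fin n → Y, (if good x y then 0 else ∏ i, P (x i, y i)) ≤ η := by
  set q := joint P W
  have hq0 : ∀ ω, 0 ≤ q ω := joint_nonneg hP hW
  have hq1 : ∑ ω, q ω = 1 := sum_joint hP hW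
  have hXh1 : Nonempty Xh1 := by
    by_contra h
    rw [not_nonempty_iff] at h
    simp at hq1
  -- the marginals needed for the one-shot code, named after the letters they keep
  let q4 : X → Y → Xh1 → Xh2 → ℝ := fun x y a b => q (x, y, a, b)
  let q3 : X → Y → Xh2 → ℝ := fun x y b => law q (fun ω => ((ω.1, ω.2.1), ω.2.2.2)) ((x, y), b)
  let qyab : Y → Xh1 → Xh2 → ℝ := fun y a b =>
    law q (fun ω => (ω.2.2.1, ω.2.1, ω.2.2.2)) (a, y, b)
  let qyb : Y → Xh2 → ℝ := fun y b => law q (fun ω => (ω.2.1, ω.2.2.2)) (y, b)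
  let qy : Y → ℝ := law q fun ω => ω.2.1
  let qb : Xh2 → ℝ := law q fun ω => ω.2.2.2
  have hlaw_id : ∀ ω, law q (fun ω => ω) ω = q ω := fun ω => by
    rw [law, Finset.sum_eq_single ω] <;> simp +contextual
  have hPxy : ∀ x y, law q (fun ω => (ω.1, ω.2.1)) (x, y) = P (x, y) := fun x y =>
    law_joint_source hW (x, y)
  have m1 : ∀ x y b, ∑ a, q4 x y a b = q3 x y b := fun x y b => by
    simp only [q4, ← hlaw_id]
    exact sum_law_fiber q (u := fun a => (x, y, a, b)) (e := fun ω => ω.2.2.1)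
      fun ω a => by simp [Prod.ext_iff]; tauto
  have m2 : ∀ y a b, ∑ x, q4 x y a b = qyab y a b := fun y a b => by
    simp only [q4, ← hlaw_id]
    exact sum_law_fiber q (u := fun x => (x, y, a, b)) (e := fun ω => ω.1)
      fun ω x => by simp [Prod.ext_iff]; tauto
  have m3 : ∀ x y, ∑ b, q3 x y b = P (x, y) := fun x y => by
    rw [← hPxy]; exact sum_law_right q (fun ω => (ω.1, ω.2.1)) (fun ω => ω.2.2.2) (x, y)
  have m4 : ∀ y b, ∑ x, q3 x y b = qyb y b := fun y b =>
    sum_law_fiber q (u := fun x => ((x, y), b)) (e := fun ω => ω.1)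
      fun ω x => by simp; tauto
  have m5 : ∀ y, ∑ b, qyb y b = qy y := sum_law_right q (fun ω => ω.2.1) (fun ω => ω.2.2.2)
  have m6 : ∀ b, ∑ y, qyb y b = qb b := sum_law_left q (fun ω => ω.2.1) (fun ω => ω.2.2.2)
  have m7 : ∑ b, qb b = 1 := (sum_law q _).trans hq1
  -- `logb 2` of these ratios are the information densities of `(x, y)` and `b`, of `y` and `b`, and of
  -- `x` and `a` given `(y, b)`
  let z1 : X × Y × Xh1 × Xh2 → ℝ := fun ω =>
    q3 ω.1 ω.2.1 ω.2.2.2 / (P (ω.1, ω.2.1) * qb ω.2.2.2)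
  let z2 : X × Y × Xh1 × Xh2 → ℝ := fun ω => qyb ω.2.1 ω.2.2.2 / (qy ω.2.1 * qb ω.2.2.2)
  let z3 : X × Y × Xh1 × Xh2 → ℝ := fun ω =>
    q ω * qyb ω.2.1 ω.2.2.2 / (q3 ω.1 ω.2.1 ω.2.2.2 * qyab ω.2.1 ω.2.2.1 ω.2.2.2)
  have p3 : ∀ ω, 0 < q ω → 0 < q3 ω.1 ω.2.1 ω.2.2.2 := fun ω h =>
    law_pos hq0 (fun ω => ((ω.1, ω.2.1), ω.2.2.2)) h
  have pyab : ∀ ω, 0 < q ω → 0 < qyab ω.2.1 ω.2.2.1 ω.2.2.2 := fun ω h =>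
    law_pos hq0 (fun ω => (ω.2.2.1, ω.2.1, ω.2.2.2)) h
  have pyb : ∀ ω, 0 < q ω → 0 < qyb ω.2.1 ω.2.2.2 := fun ω h =>
    law_pos hq0 (fun ω => (ω.2.1, ω.2.2.2)) h
  have py : ∀ ω, 0 < q ω → 0 < qy ω.2.1 := fun ω h => law_pos hq0 (fun ω => ω.2.1) h
  have pb : ∀ ω, 0 < q ω → 0 < qb ω.2.2.2 := fun ω h => law_pos hq0 (fun ω => ω.2.2.2) h
  have pxy : ∀ ω, 0 < q ω → 0 < P (ω.1, ω.2.1) := fun ω h => by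
    rw [← hPxy]; exact law_pos hq0 (fun ω => (ω.1, ω.2.1)) h
  set I2 := mutualInfo q (fun ω => (ω.1, ω.2.1)) (fun ω => ω.2.2.2) with hI2
  set I1 := condMutualInfo q (fun ω => ω.1) (fun ω => ω.2.2) (fun ω => ω.2.1) with hI1
  set IY := mutualInfo q (fun ω => ω.2.1) (fun ω => ω.2.2.2) with hIY
  set IC := condMutualInfo q (fun ω => ω.1) (fun ω => ω.2.2.2) (fun ω => ω.2.1) with hIC
  set I3 := condMutualInfo q (fun ω => ω.1) (fun ω => ω.2.2.1)
    (fun ω => (ω.2.1, ω.2.2.2)) with hI3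
  have hI2C : I2 = IY + IC := mutualInfo_chain hq0 _ _ _
  have hI1C : I1 = IC + I3 := condMutualInfo_chain hq0 _ (fun ω => ω.2.2.1) (fun ω => ω.2.2.2) _
  have hI2n : 0 ≤ I2 := mutualInfo_nonneg hq0 hq1 _ _
  have hICn : 0 ≤ IC := condMutualInfo_nonneg hq0 hq1 _ _ _
  have hI3n : 0 ≤ I3 := condMutualInfo_nonneg hq0 hq1 _ _ _
  have e1 : ∑ ω, q ω * Real.logb 2 (z1 ω) = I2 := by
    rw [hI2, mutualInfo_eq_sum]
    simp only [hPxy]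
    rfl
  have e2 : ∑ ω, q ω * Real.logb 2 (z2 ω) = IY := (mutualInfo_eq_sum q _ _).symm
  have e3 : ∑ ω, q ω * Real.logb 2 (z3 ω) = I3 := by
    rw [hI3, condMutualInfo_eq_sum]
    refine Finset.sum_congr rfl fun ω _ => ?_
    have a1 : law q (fun ω => (ω.1, ω.2.2.1, ω.2.1, ω.2.2.2))
        (ω.1, ω.2.2.1, ω.2.1, ω.2.2.2) = q ω := by
      rw [← hlaw_id ω]
      exact law_congr q (fun ω => (ω.1, ω.2.2.1, ω.2.1, ω.2.2.2)) (fun ω => ω) ω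
        fun ω' => by simp [Prod.ext_iff]; tauto
    have a2 : law q (fun ω => (ω.1, ω.2.1, ω.2.2.2)) (ω.1, ω.2.1, ω.2.2.2) =
        q3 ω.1 ω.2.1 ω.2.2.2 :=
      law_congr q (fun ω => (ω.1, ω.2.1, ω.2.2.2)) (fun ω => ((ω.1, ω.2.1), ω.2.2.2)) ω
        fun ω' => by simp; tauto
    rw [a1, a2]
  let F : Fin 5 → X × Y × Xh1 × Xh2 → ℝ :=
    ![fun ω => Real.logb 2 (z1 ω), fun ω => Real.logb 2 (z2 ω), fun ω => Real.logb 2 (z3 ω),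
      fun ω => d1 ω.1 ω.2.2.1, fun ω => d2 ω.1 ω.2.2.2]
  obtain ⟨N, hN⟩ := exists_forall_sum_prod_deviation_le hq0 hq1 F hδ
    (show 0 < η / 8 by positivity)
  have htend : Filter.Tendsto (fun n : ℕ => (2 : ℝ) ^ ((n : ℝ) * δ)) Filter.atTop Filter.atTop := by
    have h := tendsto_pow_atTop_atTop_of_one_lt
      (Real.one_lt_rpow (show (1 : ℝ) < 2 by norm_num) hδ)
    refine h.congr fun n => ?_
    rw [mul_comm, Real.rpow_mul_natCast (by norm_num)]
  obtain ⟨N', hN'⟩ := Filter.eventually_atTop.1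
    (htend.eventually_ge_atTop (max 4 (12 / η)))
  refine ⟨max (max N N') 1, fun n hn => ?_⟩
  have hnN : N ≤ n := le_trans (le_trans (le_max_left _ _) (le_max_left _ _)) hn
  have hnN' : N' ≤ n := le_trans (le_trans (le_max_right _ _) (le_max_left _ _)) hn
  have hn1 : 1 ≤ n := le_trans (le_max_right _ _) hn
  have hn0 : (0 : ℝ) < n := by exact_mod_cast hn1
  set u := (2 : ℝ) ^ ((n : ℝ) * δ) with hu
  have hu4 : 4 ≤ u := (le_max_left _ _).trans (hN' n hnN')
  have huη : 12 / η ≤ u := (le_max_right _ _).trans (hN' n hnN')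
  have hu0 : 0 < u := by linarith
  have hv : ∀ r : ℝ, 0 < (2 : ℝ) ^ ((n : ℝ) * r) := fun r => by positivity
  have hv1 : ∀ r : ℝ, 0 ≤ r → 1 ≤ (2 : ℝ) ^ ((n : ℝ) * r) := fun r hr =>
    Real.one_le_rpow (by norm_num) (by positivity)
  have hadd : ∀ r s : ℝ, (2 : ℝ) ^ ((n : ℝ) * (r + s)) =
      (2 : ℝ) ^ ((n : ℝ) * r) * (2 : ℝ) ^ ((n : ℝ) * s) := fun r s => by
    rw [mul_add, Real.rpow_add (by norm_num)]
  have hu7 : (2 : ℝ) ^ ((n : ℝ) * (7 * δ)) = u ^ 7 := by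
    rw [hu, ← Real.rpow_natCast, ← Real.rpow_mul (by norm_num)]
    congr 1; push_cast; ring
  have hYC : (2 : ℝ) ^ ((n : ℝ) * IY) * (2 : ℝ) ^ ((n : ℝ) * IC) = (2 : ℝ) ^ ((n : ℝ) * I2) := by
    rw [hI2C, hadd]
  obtain ⟨M, K, L, hM, hK, hL, hM2, hKL, herr1, herr2, herr3⟩ :=
    exists_codebook_sizes (hv IY) (hv1 IC hICn) (hv1 I3 hI3n) (by rw [hYC]; exact hv1 I2 hI2n) hu4
  rw [hYC] at hM2 herr1
  rw [← hadd, ← hI1C, ← hu7, ← hadd] at hKL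
  rw [← hu7, ← hadd] at hM2
  have hrate : ∀ r s : ℝ, r ≤ s → (2 : ℝ) ^ ((n : ℝ) * r) ≤ (2 : ℝ) ^ ((n : ℝ) * s) :=
    fun r s h => Real.rpow_le_rpow_of_exponent_le (by norm_num)
      (mul_le_mul_of_nonneg_left h hn0.le)
  -- typical quadruples of sequences; positivity of all letters makes the logarithms meaningful
  obtain ⟨T, hT⟩ : ∃ T : (Fin n → X) → (Fin n → Y) → (Fin n → Xh1) → (Fin n → Xh2) → Prop,
      ∀ x y a b, T x y a b ↔ (∀ i, 0 < q (x i, y i, a i, b i)) ∧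
        ∀ j, |∑ i, F j (x i, y i, a i, b i) - n * ∑ s, q s * F j s| < n * δ :=
    ⟨_, fun _ _ _ _ => Iff.rfl⟩
  have hTc : ∑ x, ∑ y, ∑ b, ∑ a, (if T x y a b then 0 else ∏ i, q4 (x i) (y i) (a i) (b i)) ≤
      η / 8 := by
    refine le_trans (le_of_eq ?_) (hN n hnN)
    let E : (Fin n → X × Y × Xh1 × Xh2) ≃
        (Fin n → X) × (Fin n → Y) × (Fin n → Xh2) × (Fin n → Xh1) :=
      { toFun := fun σ => (fun i => (σ i).1, fun i => (σ i).2.1, fun i => (σ i).2.2.2,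
          fun i => (σ i).2.2.1)
        invFun := fun s i => (s.1 i, s.2.1 i, s.2.2.2 i, s.2.2.1 i)
        left_inv := fun _ => rfl
        right_inv := fun _ => rfl }
    symm
    refine (Fintype.sum_equiv E _
      (fun s => if T s.1 s.2.1 s.2.2.2 s.2.2.1 then 0 else
        ∏ i, q4 (s.1 i) (s.2.1 i) (s.2.2.2 i) (s.2.2.1 i)) ?_).trans
      (by simp only [Fintype.sum_prod_type])
    · intro σ
      have hiff : T (E σ).1 (E σ).2.1 (E σ).2.2.2 (E σ).2.2.1 ↔ (∀ i, 0 < q (σ i)) ∧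
          ∀ j, |∑ i, F j (σ i) - n * ∑ s, q s * F j s| < n * δ := hT _ _ _ _
      by_cases hpos : ∀ i, 0 < q (σ i)
      · by_cases hdev : ∀ j, |∑ i, F j (σ i) - n * ∑ s, q s * F j s| < n * δ
        · rw [if_pos hdev, if_pos (hiff.2 ⟨hpos, hdev⟩)]
        · rw [if_neg hdev, if_neg fun h => hdev (hiff.1 h).2]
          rfl
      · obtain ⟨i, hi⟩ := not_forall.1 hpos
        have hz : ∏ i, q (σ i) = 0 :=
          Finset.prod_eq_zero (Finset.mem_univ i) (le_antisymm (not_lt.1 hi) (hq0 _))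
        have hz' : ∏ i, q4 ((E σ).1 i) ((E σ).2.1 i) ((E σ).2.2.2 i) ((E σ).2.2.1 i) = 0 := hz
        rw [hz, hz', ite_self, ite_self]
  have hdens : ∀ x y a b, T x y a b → ∀ (z : X × Y × Xh1 × Xh2 → ℝ) (I : ℝ),
      (∀ ω, 0 < q ω → 0 < z ω) → |∑ i, Real.logb 2 (z (x i, y i, a i, b i)) - n * I| < n * δ →
      ∏ i, z (x i, y i, a i, b i) ≤ (2 : ℝ) ^ ((n : ℝ) * I) * u ∧
        (2 : ℝ) ^ ((n : ℝ) * I) / u ≤ ∏ i, z (x i, y i, a i, b i) := by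
    intro x y a b ht z I hz habs
    rw [abs_lt] at habs
    rw [prod_eq_rpow_sum_logb fun i => hz _ (((hT x y a b).1 ht).1 i), hu,
      ← Real.rpow_add (by norm_num), ← Real.rpow_sub (by norm_num)]
    exact ⟨Real.rpow_le_rpow_of_exponent_le (by norm_num) (by linarith),
      Real.rpow_le_rpow_of_exponent_le (by norm_num) (by linarith)⟩
  have hT1 : ∀ x y a b, T x y a b →
      |∑ i, Real.logb 2 (z1 (x i, y i, a i, b i)) - n * I2| < n * δ := fun x y a b ht => by
    rw [← e1]; exact ((hT x y a b).1 ht).2 0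
  have hT2 : ∀ x y a b, T x y a b →
      |∑ i, Real.logb 2 (z2 (x i, y i, a i, b i)) - n * IY| < n * δ := fun x y a b ht => by
    rw [← e2]; exact ((hT x y a b).1 ht).2 1
  have hT3 : ∀ x y a b, T x y a b →
      |∑ i, Real.logb 2 (z3 (x i, y i, a i, b i)) - n * I3| < n * δ := fun x y a b ht => by
    rw [← e3]; exact ((hT x y a b).1 ht).2 2
  have hTα : ∀ x y a b, T x y a b → ∏ i, q3 (x i) (y i) (b i) ≤
      (2 : ℝ) ^ ((n : ℝ) * I2) * u * ((∏ i, P (x i, y i)) * ∏ i, qb (b i)) := by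
    intro x y a b ht
    have hpos := ((hT x y a b).1 ht).1
    have h := (hdens x y a b ht z1 I2 (fun ω h => div_pos (p3 ω h) (mul_pos (pxy ω h) (pb ω h)))
      (hT1 x y a b ht)).1
    simp only [z1, Finset.prod_div_distrib, Finset.prod_mul_distrib] at h
    have h1 : 0 < ∏ i, P (x i, y i) := Finset.prod_pos fun i _ => pxy _ (hpos i)
    have h2 : 0 < ∏ i, qb (b i) := Finset.prod_pos fun i _ => pb _ (hpos i)
    exact (div_le_iff₀ (mul_pos h1 h2)).1 h
  have hTl : ∀ x y a b, T x y a b → (2 : ℝ) ^ ((n : ℝ) * IY) / u *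
      ((∏ i, qy (y i)) * ∏ i, qb (b i)) ≤ ∏ i, qyb (y i) (b i) := by
    intro x y a b ht
    have hpos := ((hT x y a b).1 ht).1
    have h := (hdens x y a b ht z2 IY (fun ω h => div_pos (pyb ω h) (mul_pos (py ω h) (pb ω h)))
      (hT2 x y a b ht)).2
    simp only [z2, Finset.prod_div_distrib, Finset.prod_mul_distrib] at h
    have h1 : 0 < ∏ i, qy (y i) := Finset.prod_pos fun i _ => py _ (hpos i)
    have h2 : 0 < ∏ i, qb (b i) := Finset.prod_pos fun i _ => pb _ (hpos i)
    exact (le_div_iff₀ (mul_pos h1 h2)).1 h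
  have hTβ : ∀ x y a b, T x y a b → (∏ i, q4 (x i) (y i) (a i) (b i)) * ∏ i, qyb (y i) (b i) ≤
      (2 : ℝ) ^ ((n : ℝ) * I3) * u *
        ((∏ i, q3 (x i) (y i) (b i)) * ∏ i, qyab (y i) (a i) (b i)) := by
    intro x y a b ht
    have hpos := ((hT x y a b).1 ht).1
    have h := (hdens x y a b ht z3 I3 (fun ω h => div_pos (mul_pos h (pyb ω h))
      (mul_pos (p3 ω h) (pyab ω h))) (hT3 x y a b ht)).1
    simp only [z3, Finset.prod_div_distrib, Finset.prod_mul_distrib] at h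
    have h1 : 0 < ∏ i, q3 (x i) (y i) (b i) := Finset.prod_pos fun i _ => p3 _ (hpos i)
    have h2 : 0 < ∏ i, qyab (y i) (a i) (b i) := Finset.prod_pos fun i _ => pyab _ (hpos i)
    exact (div_le_iff₀ (mul_pos h1 h2)).1 h
  have M1 : ∀ (x : Fin n → X) (y : Fin n → Y) (b : Fin n → Xh2),
      ∑ a : Fin n → Xh1, ∏ i, q4 (x i) (y i) (a i) (b i) = ∏ i, q3 (x i) (y i) (b i) :=
    fun x y b => by simp only [sum_prod_pi (fun i a => q4 (x i) (y i) a (b i)), m1]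
  have M2 : ∀ (y : Fin n → Y) (a : Fin n → Xh1) (b : Fin n → Xh2),
      ∑ x : Fin n → X, ∏ i, q4 (x i) (y i) (a i) (b i) = ∏ i, qyab (y i) (a i) (b i) :=
    fun y a b => by simp only [sum_prod_pi (fun i x => q4 x (y i) (a i) (b i)), m2]
  have M3 : ∀ (x : Fin n → X) (y : Fin n → Y),
      ∑ b : Fin n → Xh2, ∏ i, q3 (x i) (y i) (b i) = ∏ i, P (x i, y i) :=
    fun x y => by simp only [sum_prod_pi (fun i b => q3 (x i) (y i) b), m3]
  have M4 : ∀ (y : Fin n → Y) (b : Fin n → Xh2),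
      ∑ x : Fin n → X, ∏ i, q3 (x i) (y i) (b i) = ∏ i, qyb (y i) (b i) :=
    fun y b => by simp only [sum_prod_pi (fun i x => q3 x (y i) (b i)), m4]
  have M5 : ∀ y : Fin n → Y, ∑ b : Fin n → Xh2, ∏ i, qyb (y i) (b i) = ∏ i, qy (y i) :=
    fun y => by simp only [sum_prod_pi (fun i b => qyb (y i) b), m5]
  have M6 : ∀ b : Fin n → Xh2, ∑ y : Fin n → Y, ∏ i, qyb (y i) (b i) = ∏ i, qb (b i) :=
    fun b => by simp only [sum_prod_pi (fun i y => qyb y (b i)), m6]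
  have M7 : ∑ b : Fin n → Xh2, ∏ i, qb (b i) = 1 := sum_prod_eq_one m7
  have M0 : ∀ (x : Fin n → X) (y : Fin n → Y) (a : Fin n → Xh1) (b : Fin n → Xh2),
      0 ≤ ∏ i, q4 (x i) (y i) (a i) (b i) := fun x y a b => Finset.prod_nonneg fun i _ => hq0 _
  obtain ⟨f1, f2, g1, g2, hcode⟩ := exists_oneShot_code
    (𝒳 := Fin n → X) (𝒴 := Fin n → Y) (𝒜 := Fin n → Xh1) (ℬ := Fin n → Xh2)
    (q := fun x y a b => ∏ i, q4 (x i) (y i) (a i) (b i))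
    (qxyb := fun x y b => ∏ i, q3 (x i) (y i) (b i))
    (qyab := fun y a b => ∏ i, qyab (y i) (a i) (b i))
    (qxy := fun x y => ∏ i, P (x i, y i)) (qyb := fun y b => ∏ i, qyb (y i) (b i))
    (qy := fun y => ∏ i, qy (y i)) (qb := fun b => ∏ i, qb (b i))
    M0 M1 M2 M3 M4 M5 M6 M7 (mul_pos (hv I2) hu0) (mul_pos (hv I3) hu0) (div_pos (hv IY) hu0)
    hTα hTl hTβ hM hK hL
  obtain ⟨c, hc1, hc2⟩ := exists_code_of_le (Nat.le_floor (hKL.trans (hrate _ _ hR1)))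
    (Nat.le_floor (hM2.trans (hrate _ _ hR2))) hK hL hM
    f1 f2 g1 g2
  refine ⟨c, fun x y => T x y (g1 y (f1 x y)) (g2 (f2 y (f1 x y))), fun x y ht => ?_,
    hcode.trans ?_⟩
  · rw [hc1, hc2]
    have h3 := ((hT _ _ _ _).1 ht).2 3
    have h4 := ((hT _ _ _ _).1 ht).2 4
    rw [abs_lt] at h3 h4
    simp only [seqDist, one_div, inv_mul_le_iff₀ hn0]
    refine ⟨?_, ?_⟩
    · have : ∑ i, d1 (x i) (g1 y (f1 x y) i) -
        n * ∑ ω, q ω * d1 ω.1 ω.2.2.1 < n * δ := h3.2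
      linarith
    · have : ∑ i, d2 (x i) (g2 (f2 y (f1 x y)) i) -
        n * ∑ ω, q ω * d2 ω.1 ω.2.2.2 < n * δ := h4.2
      linarith
  · have h6 : 2 / u ≤ η / 6 := by
      rw [div_le_iff₀ hη] at huη
      rw [div_le_div_iff₀ hu0 (by norm_num)]
      linarith
    linarith

/-- Rates strictly above the informations are achievable. -/
theorem achievable_of_lt {P : X × Y → ℝ} (hP : P ∈ stdSimplex ℝ (X × Y))
    {W : X × Y → Xh1 × Xh2 → ℝ} (hW : ∀ s, W s ∈ stdSimplex ℝ (Xh1 × Xh2))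
    {d1 : X → Xh1 → ℝ} (hd1 : ∀ x a, 0 ≤ d1 x a) {d2 : X → Xh2 → ℝ} (hd2 : ∀ x a, 0 ≤ d2 x a)
    {D1 D2 : ℝ} (hD1 : ∑ ω : X × Y × Xh1 × Xh2, joint P W ω * d1 ω.1 ω.2.2.1 ≤ D1)
    (hD2 : ∑ ω : X × Y × Xh1 × Xh2, joint P W ω * d2 ω.1 ω.2.2.2 ≤ D2) {R : ℝ × ℝ}
    (hR2 : mutualInfo (joint P W) (fun ω : X × Y × Xh1 × Xh2 => (ω.1, ω.2.1))
      (fun ω => ω.2.2.2) < R.2)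
    (hR1 : condMutualInfo (joint P W) (fun ω : X × Y × Xh1 × Xh2 => ω.1) (fun ω => ω.2.2)
      (fun ω => ω.2.1) < R.1) :
    Achievable P d1 d2 D1 D2 R := by
  obtain ⟨B, hB0, hB1, hB2⟩ : ∃ B : ℝ, 0 ≤ B ∧ (∀ x a, d1 x a ≤ B) ∧ ∀ x a, d2 x a ≤ B := by
    refine ⟨∑ x, ∑ a, d1 x a + ∑ x, ∑ a, d2 x a, ?_, fun x a => ?_, fun x a => ?_⟩
    · exact add_nonneg (Finset.sum_nonneg fun x _ => Finset.sum_nonneg fun a _ => hd1 x a)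
        (Finset.sum_nonneg fun x _ => Finset.sum_nonneg fun a _ => hd2 x a)
    · refine le_add_of_le_of_nonneg ?_
        (Finset.sum_nonneg fun x _ => Finset.sum_nonneg fun a _ => hd2 x a)
      exact (Finset.single_le_sum (fun a _ => hd1 x a) (Finset.mem_univ a)).trans
        (Finset.single_le_sum (f := fun x => ∑ a, d1 x a)
          (fun x _ => Finset.sum_nonneg fun a _ => hd1 x a) (Finset.mem_univ x))
    · refine le_add_of_nonneg_of_le
        (Finset.sum_nonneg fun x _ => Finset.sum_nonneg fun a _ => hd1 x a) ?_
      exact (Finset.single_le_sum (fun a _ => hd2 x a) (Finset.mem_univ a)).trans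
        (Finset.single_le_sum (f := fun x => ∑ a, d2 x a)
          (fun x _ => Finset.sum_nonneg fun a _ => hd2 x a) (Finset.mem_univ x))
  have hE1 : 0 ≤ ∑ ω : X × Y × Xh1 × Xh2, joint P W ω * d1 ω.1 ω.2.2.1 :=
    Finset.sum_nonneg fun ω _ => mul_nonneg (joint_nonneg hP hW ω) (hd1 _ _)
  have hE2 : 0 ≤ ∑ ω : X × Y × Xh1 × Xh2, joint P W ω * d2 ω.1 ω.2.2.2 :=
    Finset.sum_nonneg fun ω _ => mul_nonneg (joint_nonneg hP hW ω) (hd2 _ _)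
  intro ε hε
  obtain ⟨δ, hδ0, hδ1, hδ2, hδ3⟩ : ∃ δ : ℝ, 0 < δ ∧
      condMutualInfo (joint P W) (fun ω : X × Y × Xh1 × Xh2 => ω.1) (fun ω => ω.2.2)
        (fun ω => ω.2.1) + 7 * δ ≤ R.1 ∧
      mutualInfo (joint P W) (fun ω : X × Y × Xh1 × Xh2 => (ω.1, ω.2.1))
        (fun ω => ω.2.2.2) + 7 * δ ≤ R.2 ∧ δ ≤ ε / 2 := by
    obtain ⟨δ, h0, h⟩ := exists_between (lt_min (lt_min (div_pos (sub_pos.2 hR1) (by norm_num))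
      (div_pos (sub_pos.2 hR2) (by norm_num))) (half_pos hε) : (0 : ℝ) <
        min (min ((R.1 - _) / 7) ((R.2 - _) / 7)) (ε / 2))
    obtain ⟨⟨h1, h2⟩, h3⟩ := (lt_min_iff.1 h).imp_left lt_min_iff.1
    exact ⟨δ, h0, by linarith, by linarith, h3.le⟩
  set η := ε / 2 / (B + 1) with hη
  have hη0 : 0 < η := by positivity
  have hBη : B * η ≤ ε / 2 := by
    rw [hη, mul_div_assoc', div_le_iff₀ (by positivity)]
    nlinarith
  obtain ⟨N, hN⟩ := exists_block_code hP hW d1 d2 hδ0 hη0 hδ1 hδ2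
  refine ⟨N, fun n hn => ?_⟩
  obtain ⟨c, good, hgood, hc⟩ := hN n hn
  refine ⟨c, ?_, ?_⟩
  · refine (expectIID_seqDist_le hP hB1 hB0 (add_nonneg hE1 hδ0.le) (fun x y h => (hgood x y h).1)
      hc).trans ?_
    linarith
  · refine (expectIID_seqDist_le hP hB2 hB0 (add_nonneg hE2 hδ0.le) (fun x y h => (hgood x y h).2)
      hc).trans ?_
    linarith

end Achievability
end Cascade

theorem theorem1 {X Y Xh1 Xh2 : Type*} [Fintype X] [Fintype Y] [Fintype Xh1] [Fintype Xh2]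
    (P : X × Y → ℝ) (hP : P ∈ stdSimplex ℝ (X × Y))
    (d1 : X → Xh1 → ℝ) (hd1 : ∀ x a, 0 ≤ d1 x a)
    (d2 : X → Xh2 → ℝ) (hd2 : ∀ x a, 0 ≤ d2 x a)
    (D1 D2 : ℝ) :
    Cascade.operationalRegion P d1 d2 D1 D2 = Cascade.singleLetterRegion P d1 d2 D1 D2 := by
  refine Set.Subset.antisymm (Cascade.operationalRegion_subset hP d1 d2 D1 D2) ?_
  rintro ⟨R1, R2⟩ ⟨W, hW, hD1, hD2, h2, h1⟩
  -- a margin in both rates, which the closure absorbs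
  refine Metric.mem_closure_iff.2 fun ε hε => ⟨(R1 + ε / 2, R2 + ε / 2),
    Cascade.achievable_of_lt hP hW hd1 hd2 hD1 hD2 (lt_of_le_of_lt h2 (by simp [hε]))
      (lt_of_le_of_lt h1 (by simp [hε])), ?_⟩
  rw [Prod.dist_eq, max_lt_iff, Real.dist_eq, Real.dist_eq, abs_lt, abs_lt]
  refine ⟨⟨?_, ?_⟩, ⟨?_, ?_⟩⟩ <;> dsimp only <;> linarith
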